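/- Let $(M,g)$ be an oriented smooth four-dimensional space-time of signature $(-,+,+,+)$, with metric volume element $\eta$ and Levi-Civita connection $\nabla$. Let $V$ be a smooth time-like 2-plane distribution with volume element $U$ (the canonical 2-form), let $v=U^2$ (that is, $v_{\alpha\beta}=U_\alpha{}^{\mu}U_{\mu\beta}$) be the orthogonal projector on $V$ and $h=g-v$ the projector on its orthogonal complement $H$. Suppose that the 2+2 structure is umbilical: for $P=v$ and for $P=h$, the symmetric part $S_P$ of the second fundamental form $Q_P(x,y)=(1-P)\big(\nabla_{P(x)}P(y)\big)$ satisfies $S_P=\tfrac12\,P\otimes\operatorname{tr}S_P$. Let $*$ be the Hodge dual, $(*F)_{\alpha\beta}=\tfrac12\eta_{\alpha\beta\mu\nu}F^{\mu\nu}$, let $\delta$ be the codifferential of 2-forms, $(\delta F)_\beta=-\nabla^\alpha F_{\alpha\beta}$, write $A(x)_\mu=A_{\mu\nu}x^\nu$, and let $$\Phi=*U(\delta{*U})-U(\delta U),\qquad \Psi=*U(\delta U)+U(\delta{*U})$$ be the expansion and rotation vectors of the structure. Put $\Phi\stackrel{\sim}{\otimes}\Psi=\Phi\otimes\Psi+\Psi\otimes\Phi$,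 let $\mathcal L_\Psi$ be the Lie derivative along the vector field metrically equivalent to $\Psi$, and for a covariant 2-tensor $t$ let $v(t)(x,y)=t(v(x),v(y))$ and $h(t)(x,y)=t(h(x),h(y))$ be the total projections. Then there are scalar functions $\lambda,\mu$ on $M$ such that $$v\big(\mathcal L_\Psi g-\Phi\stackrel{\sim}{\otimes}\Psi\big)=\lambda\,v,\qquad h\big(\mathcal L_\Psi g-\Phi\stackrel{\sim}{\otimes}\Psi\big)=\mu\,h,$$ and they are given by the traces: $\lambda=\tfrac12\operatorname{tr}_g v\big(\mathcal L_\Psi g-\Phi\stackrel{\sim}{\otimes}\Psi\big)$ and $\mu=\tfrac12\operatorname{tr}_g h\big(\mathcal L_\Psi g-\Phi\stackrel{\sim}{\otimes}\Psi\big)$. -/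

import Mathlib

open scoped Manifold ContDiff Bundle

noncomputable section

namespace SpaceTime

/-- The model space of a four-dimensional manifold. -/
abbrev E4 : Type := EuclideanSpace ℝ (Fin 4)

/-- The tangent space of a four-dimensional manifold. -/
abbrev T {M : Type*} [TopologicalSpace M] [ChartedSpace E4 M] (x : M) : Type :=
  TangentSpace (𝓡 4) x

/-- The signs of the signature `(-,+,+,+)`. -/
def sgn (i : Fin 4) : ℝ := if i = 0 then -1 else 1

section

variable (M : Type*) [TopologicalSpace M] [ChartedSpace E4 M]

/-- Covariant 2-tensor fields: a function of two tangent vectors at every point. -/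
abbrev Tensor2 : Type _ := ∀ x : M, T x → T x → ℝ

/-- Fields of 1-forms. -/
abbrev OneForm : Type _ := ∀ x : M, T x → ℝ

/-- Fields of endomorphisms of the tangent spaces. -/
abbrev EndField : Type _ := ∀ x : M, T x → T x

variable [IsManifold (𝓡 4) ∞ M]

/-- A smooth covariant 2-tensor field, that is, a smooth section of the bundle of bilinear forms on
the tangent spaces. -/
def IsSmoothTensor2 (B : ∀ x : M, T x →L[ℝ] T x →L[ℝ] ℝ) : Prop :=
  ContMDiff (𝓡 4) ((𝓡 4).prod 𝓘(ℝ, E4 →L[ℝ] E4 →L[ℝ] ℝ)) ∞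
    (fun x : M => Bundle.TotalSpace.mk' (E4 →L[ℝ] E4 →L[ℝ] ℝ)
      (E := fun x : M => T x →L[ℝ] T x →L[ℝ] ℝ) x (B x))

/-- A smooth metric of signature `(-,+,+,+)`. -/
structure LorentzMetric where
  /-- The scalar product of the tangent spaces. -/
  inner : ∀ x : M, T x →L[ℝ] T x →L[ℝ] ℝ
  symm : ∀ (x : M) (X Y : T x), inner x X Y = inner x Y X
  signature : ∀ x : M, ∃ e : Fin 4 → T x,
    ∀ i j, inner x (e i) (e j) = if i = j then sgn i else 0
  smooth : IsSmoothTensor2 M inner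

end

variable {M : Type*} [TopologicalSpace M] [ChartedSpace E4 M] [IsManifold (𝓡 4) ∞ M]

/-- `e` is an orthonormal frame of the tangent space at `x`, with `e 0` time-like. -/
def LorentzMetric.IsOrthonormal (g : LorentzMetric M) {x : M} (e : Fin 4 → T x) : Prop :=
  ∀ i j, g.inner x (e i) (e j) = if i = j then sgn i else 0

/-- The metric as a covariant 2-tensor field. -/
def LorentzMetric.tensor (g : LorentzMetric M) : Tensor2 M := fun x X Y => g.inner x X Y

/-- An orthonormal frame at `x`. It only serves to write contractions of indices, which do not
depend on the choice. -/
def LorentzMetric.frame (g : LorentzMetric M) (x : M) : Fin 4 → T x :=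
  Classical.choose (g.signature x)

theorem LorentzMetric.frame_isOrthonormal (g : LorentzMetric M) (x : M) :
    g.IsOrthonormal (g.frame x) :=
  Classical.choose_spec (g.signature x)

/-- The volume element of an orientation of `(M, g)`: a smooth 4-form with values `± 1` on
orthonormal frames. It exists precisely when `M` is orientable, and choosing it is choosing an
orientation. -/
structure VolumeElement (g : LorentzMetric M) where
  /-- The 4-form. -/
  form : ∀ x : M, (T x) [⋀^Fin 4]→ₗ[ℝ] ℝ
  normalized : ∀ (x : M) (e : Fin 4 → T x), g.IsOrthonormal e → form x e ^ 2 = 1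
  smooth : ∀ (x : M) (X : Fin 4 → ∀ y : M, T y),
    (∀ i, ContMDiffAt (𝓡 4) (𝓡 4).tangent ∞
      (fun y : M => (⟨y, X i y⟩ : TangentBundle (𝓡 4) M)) x) →
    ContMDiffAt (𝓡 4) 𝓘(ℝ, ℝ) ∞ (fun y : M => form y (fun i => X i y)) x

/-! ### Algebra of tensors -/

/-- Raising the index of a 1-form at a point. -/
def sharp (g : LorentzMetric M) (x : M) (α : T x → ℝ) : T x :=
  ∑ i, (sgn i * α (g.frame x i)) • g.frame x i

/-- The metric trace of a covariant 2-tensor at a point, with values in `ℝ` or in the tangent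
space. -/
def trace (g : LorentzMetric M) (x : M) {W : Type*} [AddCommGroup W] [Module ℝ W]
    (B : T x → T x → W) : W :=
  ∑ i, sgn i • B (g.frame x i) (g.frame x i)

/-- The endomorphism with components `A_α^μ`, mapping `X^α` to `X^α A_α^μ`. -/
def toEnd (g : LorentzMetric M) (A : Tensor2 M) : EndField M :=
  fun x X => sharp g x (A x X)

/-- The 1-form `A(w)` with components `A_{μν} w^ν`. -/
def applyVec (A : Tensor2 M) (w : ∀ x : M, T x) : OneForm M :=
  fun x X => A x X (w x)

/-- The vector field metrically equivalent to a 1-form. -/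
def sharpField (g : LorentzMetric M) (α : OneForm M) : ∀ x : M, T x :=
  fun x => sharp g x (α x)

/-- The Hodge dual of a 2-form, `(*F)_{αβ} = (1/2) η_{αβμν} F^{μν}`. -/
def hodge (g : LorentzMetric M) (η : VolumeElement g) (F : Tensor2 M) : Tensor2 M :=
  fun x X Y => (1 / 2) * ∑ i, ∑ j, sgn i * sgn j *
    η.form x ![X, Y, g.frame x i, g.frame x j] * F x (g.frame x i) (g.frame x j)

/-- The symmetrized product `α ⊗ β + β ⊗ α`. -/
def symProd (α β : OneForm M) : Tensor2 M := fun x X Y => α x X * β x Y + β x X * α x Y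

/-- The total projection `P(t)` of a covariant 2-tensor by a projector `P`. -/
def totalProj (P : EndField M) (t : Tensor2 M) : Tensor2 M := fun x X Y => t x (P x X) (P x Y)

/-! ### Differential operators

Vectors at a point are extended to vector fields with `FiberBundle.extend`; the quantities below
are tensorial in these arguments and do not depend on the extension. -/

/-- A vector field near `x` that extends the tangent vector `X`. -/
def ext {x : M} (X : T x) : ∀ y : M, T y :=
  FiberBundle.extend (E := fun y : M => TangentSpace (𝓡 4) y) E4 X

/-- The right-hand side of the Koszul formula. -/
def koszul (g : LorentzMetric M) (X Y Z : ∀ y : M, T y) (x : M) : ℝ :=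
  mvfderiv (𝓡 4) (fun y : M => g.inner y (Y y) (Z y)) x (X x)
  + mvfderiv (𝓡 4) (fun y : M => g.inner y (X y) (Z y)) x (Y x)
  - mvfderiv (𝓡 4) (fun y : M => g.inner y (X y) (Y y)) x (Z x)
  + g.inner x (VectorField.mlieBracket (𝓡 4) X Y x) (Z x)
  - g.inner x (VectorField.mlieBracket (𝓡 4) X Z x) (Y x)
  - g.inner x (VectorField.mlieBracket (𝓡 4) Y Z x) (X x)

/-- The Levi-Civita covariant derivative `∇_X Y` at `x` of a vector field `Y` in the direction of
the tangent vector `X`: the vector with `2 g(∇_X Y, Z) = koszul X Y Z` for all `Z`. -/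
def nabla (g : LorentzMetric M) {x : M} (X : T x) (Y : ∀ y : M, T y) : T x :=
  sharp g x (fun Z => (1 / 2) * koszul g (ext X) Y (ext Z) x)

/-- The covariant derivative `(∇_X B)(Y, Z)` of a covariant 2-tensor field. -/
def nablaTensor (g : LorentzMetric M) (B : Tensor2 M) (x : M) (X Y Z : T x) : ℝ :=
  mvfderiv (𝓡 4) (fun y : M => B y (ext Y y) (ext Z y)) x X
  - B x (nabla g X (ext Y)) Z - B x Y (nabla g X (ext Z))

/-- The exterior codifferential of a 2-form, `(δF)_β = - ∇^α F_{αβ}`. -/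
def codiff (g : LorentzMetric M) (F : Tensor2 M) : OneForm M :=
  fun x Z => - trace g x (fun X Y => nablaTensor g F x X Y Z)

/-- The Lie derivative of a covariant 2-tensor field along the vector field `W`. -/
def lieDeriv (W : ∀ y : M, T y) (B : Tensor2 M) : Tensor2 M :=
  fun x X Y =>
    mvfderiv (𝓡 4) (fun y : M => B y (ext X y) (ext Y y)) x (W x)
    - B x (VectorField.mlieBracket (𝓡 4) W (ext X) x) Y
    - B x X (VectorField.mlieBracket (𝓡 4) W (ext Y) x)

/-! ### Two-dimensional distributions and 2+2 structures -/

/-- The generalized second fundamental form `Q(X, Y) = (1 - P)(∇_{P X} (P Y))` of the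
distribution with orthogonal projector `P`. -/
def secondForm (g : LorentzMetric M) (P : EndField M) (x : M) (X Y : T x) : T x :=
  nabla g (P x X) (fun y => P y (ext Y y))
    - P x (nabla g (P x X) (fun y => P y (ext Y y)))

/-- The symmetric part of the generalized second fundamental form. -/
def symSecondForm (g : LorentzMetric M) (P : EndField M) (x : M) (X Y : T x) : T x :=
  (1 / 2 : ℝ) • (secondForm g P x X Y + secondForm g P x Y X)

/-- The 2-plane distribution with orthogonal projector `P` is umbilical: the traceless part of the
symmetric part of its second fundamental form vanishes. -/
def IsUmbilicalPlane (g : LorentzMetric M) (P : EndField M) : Prop :=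
  ∀ (x : M) (X Y : T x), symSecondForm g P x X Y =
    ((1 / 2) * g.inner x (P x X) Y) • trace g x (symSecondForm g P x)

/-- A 2+2 almost-product structure on `(M, g)`, given by its canonical 2-form `U`: a smooth 2-form
which at every point is the volume element of a time-like plane, spanned by the vectors `e 0` and
`e 1` of an orthonormal frame. -/
structure Structure22 (g : LorentzMetric M) where
  /-- The canonical 2-form. -/
  U : ∀ x : M, T x →L[ℝ] T x →L[ℝ] ℝ
  smooth : IsSmoothTensor2 M U
  volume_timelike : ∀ x : M, ∃ e : Fin 4 → T x, g.IsOrthonormal e ∧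
    ∀ X Y, U x X Y = g.inner x (e 0) X * g.inner x (e 1) Y - g.inner x (e 0) Y * g.inner x (e 1) X

variable {g : LorentzMetric M}

/-- The canonical 2-form as a covariant 2-tensor field. -/
def Structure22.form (S : Structure22 g) : Tensor2 M := fun x X Y => S.U x X Y

/-- The projector `v = U²` on the time-like plane `V`. -/
def Structure22.v (S : Structure22 g) : EndField M :=
  fun x X => toEnd g S.form x (toEnd g S.form x X)

/-- The projector `h = g - v` on the space-like plane `H` orthogonal to `V`. -/
def Structure22.h (S : Structure22 g) : EndField M := fun x X => X - S.v x X

/-- The structure is umbilical: both `V` and `H` are umbilical. -/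
def Structure22.IsUmbilical (S : Structure22 g) : Prop :=
  IsUmbilicalPlane g S.v ∧ IsUmbilicalPlane g S.h

/-- The expansion 1-form `Φ = *U(δ*U) - U(δU)`. -/
def Structure22.expansion (S : Structure22 g) (η : VolumeElement g) : OneForm M :=
  applyVec (hodge g η S.form) (sharpField g (codiff g (hodge g η S.form)))
    - applyVec S.form (sharpField g (codiff g S.form))

/-- The rotation 1-form `Ψ = *U(δU) + U(δ*U)`. -/
def Structure22.rotation (S : Structure22 g) (η : VolumeElement g) : OneForm M :=
  applyVec (hodge g η S.form) (sharpField g (codiff g S.form))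
    + applyVec S.form (sharpField g (codiff g (hodge g η S.form)))

/-- The symmetric tensor `𝓛_Ψ g - (Φ ⊗ Ψ + Ψ ⊗ Φ)`. -/
def Structure22.N (S : Structure22 g) (η : VolumeElement g) : Tensor2 M :=
  lieDeriv (sharpField g (S.rotation η)) g.tensor
    - symProd (S.expansion η) (S.rotation η)

end SpaceTime

end

open scoped Manifold ContDiff Bundle

noncomputable section

namespace SpaceTime

set_option linter.unusedSectionVars false

variable {M : Type*} [TopologicalSpace M] [ChartedSpace E4 M] [IsManifold (𝓡 4) ∞ M]
  {g : LorentzMetric M}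

/-! ### Linear algebra of orthonormal frames -/

/-! The claim is local, and it reduces to four scalar equations in an adapted orthonormal frame, one
with `U = θ_0 ∧ θ_1` and `*U = t θ_2 ∧ θ_3`, `t = ±1`. For `N = 𝓛_Ψ g - (Φ ⊗ Ψ + Ψ ⊗ Φ)` they are
`N_00 + N_11 = 0` and `N_01 = 0` on the time-like plane, `N_22 = N_33` and `N_23 = 0` on the
space-like one: the trace-free part of `N` on each plane vanishes.

Write `G_abc = g(∇_{e_a} e_b, e_c)` and `C_abc = g([e_a, e_b], e_c)`. Up to the factor `±t`, the
components of `Ψ` are the `C_23c` with `c` in `{0, 1}` and the `C_01c` with `c` in `{2, 3}`, the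
obstructions to integrability of the two planes (`rotation_frame`); `Φ` collects the traces of the
two second fundamental forms (`expansion_frame`). Hence the derivative part of `N` on `V` consists
of derivatives of the `C_23c` along `V`, and such derivatives are linked by the Jacobi identity for
two vectors of `H` and one of `V`. That identity also differentiates mixed coefficients such as
`C_03c`. In the trace-free combinations these enter only through trace-free symmetric parts of
second fundamental forms, which umbilicity kills on a whole neighbourhood, and through pairs
cancelled by the antisymmetry of `G` in its last two indices. The quadratic terms left over are
exactly the connection terms of `𝓛_Ψ g` and the product of `Φ` and `Ψ`. The plane `H` is treated in
the same way with the roles exchanged.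

The algebra is `umbilical_algebra`; its inputs are `jacobi`, `umbilicalRelations` with its
differentiated form `umbilicalRelations_dir`, and `N_frame`. The remaining work is to construct the
frame (`exists_adaptedFrame`) and to free the definitions from their pointwise choices of frames and
extensions. -/

theorem sgn_mul_self (i : Fin 4) : sgn i * sgn i = 1 := by
  unfold sgn; split_ifs <;> norm_num

theorem finrank_T (x : M) : Module.finrank ℝ (T x) = 4 :=
  (finrank_euclideanSpace_fin : Module.finrank ℝ E4 = 4)

namespace LorentzMetric.IsOrthonormal

variable {x : M} {e : Fin 4 → T x}

theorem inner_sum (he : g.IsOrthonormal e) (c : Fin 4 → ℝ) (j : Fin 4) :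
    g.inner x (e j) (∑ i, c i • e i) = sgn j * c j := by
  simp [he j, mul_comm]

theorem linearIndependent (he : g.IsOrthonormal e) : LinearIndependent ℝ e := by
  rw [Fintype.linearIndependent_iff]
  intro c hc i
  have h := he.inner_sum c i
  rw [hc, map_zero] at h
  have := congrArg (sgn i * ·) h
  simp only [mul_zero, ← mul_assoc, sgn_mul_self, one_mul] at this
  exact this.symm

/-- The basis of an orthonormal frame. -/
def basis (he : g.IsOrthonormal e) : Module.Basis (Fin 4) ℝ (T x) :=
  basisOfLinearIndependentOfCardEqFinrank he.linearIndependent (by simp [finrank_T])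

theorem basis_apply (he : g.IsOrthonormal e) (i : Fin 4) : he.basis i = e i := by
  simp [basis]

theorem expand (he : g.IsOrthonormal e) (Z : T x) :
    Z = ∑ i, (sgn i * g.inner x (e i) Z) • e i := by
  have h := he.basis.sum_repr Z
  simp only [he.basis_apply] at h
  have hc : ∀ j, g.inner x (e j) Z = sgn j * he.basis.repr Z j := by
    intro j
    conv_lhs => rw [← h]
    exact he.inner_sum _ j
  conv_lhs => rw [← h]
  refine Finset.sum_congr rfl fun i _ => ?_
  rw [hc, ← mul_assoc, sgn_mul_self, one_mul]

theorem ext_inner (he : g.IsOrthonormal e) {A B : T x}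
    (h : ∀ i, g.inner x A (e i) = g.inner x B (e i)) : A = B := by
  rw [he.expand A, he.expand B]
  exact Finset.sum_congr rfl fun i _ => by rw [g.symm x (e i) A, g.symm x (e i) B, h i]

theorem inner_expand (he : g.IsOrthonormal e) (A B : T x) :
    g.inner x A B = ∑ i, sgn i * g.inner x A (e i) * g.inner x B (e i) := by
  conv_lhs => rw [he.expand B]
  simp only [map_sum, map_smul, smul_eq_mul]
  exact Finset.sum_congr rfl fun i _ => by rw [g.symm x (e i) B]; ring

/-- Contractions are defined through `g.frame`, chosen separately at each point and possibly
discontinuous. Passing to an arbitrary orthonormal frame is what makes them differentiable later on.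
-/
theorem trace_eq {W : Type*} [AddCommGroup W] [Module ℝ W] (he : g.IsOrthonormal e)
    {B : T x → T x → W} (hB : IsBilinearMap ℝ B) :
    trace g x B = ∑ i, sgn i • B (e i) (e i) := by
  obtain ⟨L, rfl⟩ : ∃ L : T x →ₗ[ℝ] T x →ₗ[ℝ] W, B = fun X Y => L X Y :=
    ⟨hB.toLinearMap, rfl⟩
  have hf := g.frame_isOrthonormal x
  set f := g.frame x
  -- Pseudo-orthogonality of the change of frame: up to `sgn j * sgn k`, the sum is `g(e j, e k)`
  -- computed in the frame `f`.
  have key : ∀ j k, ∑ i, sgn i * (sgn j * g.inner x (e j) (f i)) * (sgn k * g.inner x (e k) (f i))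
      = if j = k then sgn j else 0 := by
    intro j k
    have h1 := hf.inner_expand (e j) (e k)
    rw [he j k] at h1
    have h2 : ∑ i, sgn i * (sgn j * g.inner x (e j) (f i)) * (sgn k * g.inner x (e k) (f i))
        = sgn j * sgn k * ∑ i, sgn i * g.inner x (e j) (f i) * g.inner x (e k) (f i) := by
      rw [Finset.mul_sum]
      exact Finset.sum_congr rfl fun i _ => by ring
    rw [h2, ← h1]
    split_ifs with h
    · subst h; rw [sgn_mul_self, one_mul]
    · simp
  calc trace g x (fun X Y => L X Y)
      = ∑ i, sgn i • ∑ j, ∑ k, ((sgn j * g.inner x (e j) (f i)) * (sgn k * g.inner x (e k) (f i))) •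
          L (e j) (e k) := by
        refine Finset.sum_congr rfl fun i _ => ?_
        change sgn i • L (f i) (f i) = _
        congr 1
        conv_lhs => rw [he.expand (f i)]
        simp only [map_sum, map_smul, LinearMap.sum_apply, LinearMap.smul_apply, Finset.smul_sum,
          smul_smul]
        rw [Finset.sum_comm]
        simp only [mul_comm]
    _ = ∑ j, ∑ k, (∑ i, sgn i * (sgn j * g.inner x (e j) (f i)) *
          (sgn k * g.inner x (e k) (f i))) • L (e j) (e k) := by
        simp only [Finset.smul_sum, smul_smul, Finset.sum_smul]
        rw [Finset.sum_comm]
        refine Finset.sum_congr rfl fun j _ => ?_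
        rw [Finset.sum_comm]
        simp only [mul_assoc]
    _ = _ := by simp only [key, ite_smul, zero_smul, Finset.sum_ite_eq, Finset.mem_univ, if_true]

theorem sharp_eq (he : g.IsOrthonormal e) {α : T x → ℝ} (hα : IsLinearMap ℝ α) :
    sharp g x α = ∑ i, (sgn i * α (e i)) • e i := by
  have hB : IsBilinearMap ℝ (fun X Y : T x => α X • Y) :=
    { add_left := fun a b c => by simp [hα.map_add, add_smul]
      smul_left := fun c a b => by simp [hα.map_smul, mul_smul]
      add_right := fun a b c => by simp
      smul_right := fun c a b => by exact smul_comm _ _ _ }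
  simpa [trace, sharp, smul_smul] using he.trace_eq hB

end LorentzMetric.IsOrthonormal

theorem inner_sharp {x : M} {α : T x → ℝ} (hα : IsLinearMap ℝ α) (Z : T x) :
    g.inner x (sharp g x α) Z = α Z := by
  have hf := g.frame_isOrthonormal x
  obtain ⟨L, rfl⟩ : ∃ L : T x →ₗ[ℝ] ℝ, α = fun X => L X := ⟨hα.mk' α, rfl⟩
  conv_rhs => rw [hf.expand Z]
  simp only [sharp, map_sum, map_smul, _root_.sum_apply, _root_.smul_apply,
    smul_eq_mul]
  exact Finset.sum_congr rfl fun i _ => by ring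

theorem LorentzMetric.eq_of_inner_eq {x : M} {A B : T x} (h : ∀ Z, g.inner x A Z = g.inner x B Z) :
    A = B :=
  (g.frame_isOrthonormal x).ext_inner fun _ => h _

/-! ### Differentiability -/

/-- The vector field `X` is of class `C^n` at `x`. -/
abbrev SmoothAt (n : ℕ∞ω) (X : ∀ y : M, T y) (x : M) : Prop :=
  ContMDiffAt (𝓡 4) (𝓡 4).tangent n (fun y : M => (⟨y, X y⟩ : TangentBundle (𝓡 4) M)) x

/-- The vector field `X` is differentiable at `x`. -/
abbrev DiffAt (X : ∀ y : M, T y) (x : M) : Prop :=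
  MDifferentiableAt (𝓡 4) (𝓡 4).tangent (fun y : M => (⟨y, X y⟩ : TangentBundle (𝓡 4) M)) x

/-- The function `f` is differentiable at `x`. -/
abbrev FDiffAt (f : M → ℝ) (x : M) : Prop := MDifferentiableAt (𝓡 4) 𝓘(ℝ, ℝ) f x

/-- The derivative of the function `f` at `x` in the direction `X`. -/
abbrev dir (f : M → ℝ) {x : M} (X : T x) : ℝ := mvfderiv (𝓡 4) f x X

section Calculus

variable {x : M} {X X' Y Y' Z Z' : ∀ y : M, T y} {f f' : M → ℝ}

theorem contMDiffAt_bilin {B : ∀ x : M, T x →L[ℝ] T x →L[ℝ] ℝ} (hB : IsSmoothTensor2 M B)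
    {n : ℕ∞} (hX : SmoothAt n X x) (hY : SmoothAt n Y x) :
    ContMDiffAt (𝓡 4) 𝓘(ℝ, ℝ) n (fun y => B y (X y) (Y y)) x := by
  have hB' := (hB x).of_le (m := (n : ℕ∞ω)) (by exact_mod_cast le_top)
  have : ContMDiffAt (𝓡 4) ((𝓡 4).prod 𝓘(ℝ, ℝ)) n
      (fun m ↦ Bundle.TotalSpace.mk' ℝ (E := Bundle.Trivial M ℝ) m (B m (X m) (Y m))) x :=
    ContMDiffAt.clm_bundle_apply₂ (F₁ := E4) (F₂ := E4) hB' hX hY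
  simp only [Bundle.contMDiffAt_totalSpace] at this
  exact this.2

theorem FDiffAt.inner (hX : DiffAt X x) (hY : DiffAt Y x) :
    FDiffAt (fun y => g.inner y (X y) (Y y)) x := by
  have hB' := (g.smooth x).mdifferentiableAt (by simp)
  have : MDifferentiableAt (𝓡 4) ((𝓡 4).prod 𝓘(ℝ, ℝ))
      (fun m ↦ Bundle.TotalSpace.mk' ℝ (E := Bundle.Trivial M ℝ) m (g.inner m (X m) (Y m))) x :=
    MDifferentiableAt.clm_bundle_apply₂ (F₁ := E4) (F₂ := E4) hB' hX hY
  simp only [mdifferentiableAt_totalSpace] at this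
  exact this.2

theorem diffAt_ext (X : T x) : DiffAt (ext X) x :=
  FiberBundle.mdifferentiableAt_extend (𝓡 4) E4 X

@[simp]
theorem ext_apply_self (X : T x) : ext X x = X :=
  FiberBundle.extend_apply_self (E := fun y : M => TangentSpace (𝓡 4) y) E4 X

theorem dir_add (hf : FDiffAt f x) (hf' : FDiffAt f' x) (V : T x) :
    dir (fun y => f y + f' y) V = dir f V + dir f' V := by
  simp [dir, mvfderiv_fun_add hf hf']

theorem dir_mul (hf : FDiffAt f x) (hf' : FDiffAt f' x) (V : T x) :
    dir (fun y => f y * f' y) V = f x * dir f' V + f' x * dir f V := by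
  simp [dir, mvfderiv_fun_mul hf hf']

theorem dir_const (c : ℝ) (V : T x) : dir (fun _ => c) V = 0 := by
  simp [dir, mvfderiv_const]

theorem dir_congr (h : f =ᶠ[nhds x] f') (V : T x) : dir f V = dir f' V := by
  have : mfderiv (𝓡 4) 𝓘(ℝ, ℝ) f x = mfderiv (𝓡 4) 𝓘(ℝ, ℝ) f' x := h.mfderiv_eq
  change NormedSpace.fromTangentSpace (f x) (mfderiv (𝓡 4) 𝓘(ℝ, ℝ) f x V) = _
  rw [this]
  rfl

theorem dir_const_mul (c : ℝ) (hf : FDiffAt f x) (V : T x) :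
    dir (fun y => c * f y) V = c * dir f V := by
  rw [dir_mul mdifferentiableAt_const hf, dir_const]; ring

theorem DiffAt.zero : DiffAt (0 : ∀ y : M, T y) x :=
  Bundle.mdifferentiable_zeroSection ℝ (fun y : M => TangentSpace (𝓡 4) y) x

theorem DiffAt.add (hX : DiffAt X x) (hY : DiffAt Y x) : DiffAt (X + Y) x :=
  mdifferentiableAt_add_section hX hY

theorem DiffAt.smul (hX : DiffAt X x) (hf : FDiffAt f x) : DiffAt (f • X) x :=
  MDifferentiableAt.smul_section hf hX

theorem DiffAt.sum {ι : Type*} {s : Finset ι} {e : ι → ∀ y : M, T y}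
    (he : ∀ i ∈ s, DiffAt (e i) x) : DiffAt (∑ i ∈ s, e i) x :=
  Finset.sum_induction _ (fun X => DiffAt X x) (fun _ _ => DiffAt.add) DiffAt.zero he

theorem mlieBracket_sum_smul_right {ι : Type*} (s : Finset ι) {f : ι → M → ℝ}
    {e : ι → ∀ y : M, T y} (hf : ∀ i ∈ s, FDiffAt (f i) x) (he : ∀ i ∈ s, DiffAt (e i) x) :
    VectorField.mlieBracket (𝓡 4) X (∑ i ∈ s, f i • e i) x =
      ∑ i ∈ s, (dir (f i) (X x) • e i x + f i x • VectorField.mlieBracket (𝓡 4) X (e i) x) := by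
  classical
  induction s using Finset.induction_on with
  | empty => simp
  | insert a s ha ih =>
    have h1 := hf a (by simp)
    have h2 := he a (by simp)
    have hf' : ∀ i ∈ s, FDiffAt (f i) x := fun i hi => hf i (by simp [hi])
    have he' : ∀ i ∈ s, DiffAt (e i) x := fun i hi => he i (by simp [hi])
    simp only [Finset.sum_insert ha]
    rw [VectorField.mlieBracket_add_right (h2.smul h1)
      (DiffAt.sum fun i hi => (he' i hi).smul (hf' i hi)),
      VectorField.mlieBracket_smul_right h1 h2, ih hf' he']

end Calculus

/-! ### The Levi-Civita connection -/

section Koszul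

variable {x : M} {X Y Z W : ∀ y : M, T y}

/-- The terms in which `f` is differentiated cancel: those from the first two derivatives of the
metric against those from the brackets `[X, fZ]` and `[Y, fZ]`. -/
theorem tensorialAt_koszul_right (hX : DiffAt X x) (hY : DiffAt Y x) :
    TensorialAt (𝓡 4) E4 (fun Z => koszul g X Y Z x) x where
  smul {f Z} hf hZ := by
    have e1 := dir_mul hf (FDiffAt.inner (g := g) hY hZ) (X x)
    have e2 := dir_mul hf (FDiffAt.inner (g := g) hX hZ) (Y x)
    simp only [dir] at e1 e2
    simp only [koszul, Pi.smul_apply', map_smul, smul_eq_mul, e1, e2,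
      VectorField.mlieBracket_smul_right hf hZ, map_add, _root_.add_apply, _root_.smul_apply]
    rw [g.symm x (Z x) (Y x), g.symm x (Z x) (X x)]
    ring
  add {Z Z'} hZ hZ' := by
    have e1 := dir_add (FDiffAt.inner (g := g) hY hZ) (FDiffAt.inner (g := g) hY hZ') (X x)
    have e2 := dir_add (FDiffAt.inner (g := g) hX hZ) (FDiffAt.inner (g := g) hX hZ') (Y x)
    simp only [dir] at e1 e2
    simp only [koszul, Pi.add_apply, map_add, e1, e2,
      VectorField.mlieBracket_add_right hZ hZ', _root_.add_apply]
    ring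

/-- This becomes metric compatibility: apart from the first term, the Koszul expression is
antisymmetric in `Y` and `Z`. -/
theorem koszul_add_koszul_swap_right :
    koszul g X Y Z x + koszul g X Z Y x =
      2 * mvfderiv (𝓡 4) (fun y => g.inner y (Y y) (Z y)) x (X x) := by
  simp only [koszul, fun y => g.symm y (Z y) (Y y),
    VectorField.mlieBracket_swap_apply (V := Z) (W := Y), map_neg, _root_.neg_apply]
  ring

theorem koszul_sub_koszul_swap :
    koszul g X Y Z x - koszul g Y X Z x =
      2 * g.inner x (VectorField.mlieBracket (𝓡 4) X Y x) (Z x) := by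
  simp only [koszul, fun y => g.symm y (Y y) (X y),
    VectorField.mlieBracket_swap_apply (V := Y) (W := X), map_neg, _root_.neg_apply]
  ring

theorem tensorialAt_koszul_left (hY : DiffAt Y x) (hZ : DiffAt Z x) :
    TensorialAt (𝓡 4) E4 (fun X => koszul g X Y Z x) x where
  smul {f X} hf hX := by
    have e1 := dir_mul hf (FDiffAt.inner (g := g) hX hZ) (Y x)
    have e2 := dir_mul hf (FDiffAt.inner (g := g) hX hY) (Z x)
    simp only [dir] at e1 e2
    simp only [koszul, Pi.smul_apply', map_smul, smul_eq_mul, e1, e2,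
      VectorField.mlieBracket_smul_left hf hX, map_add, _root_.add_apply, _root_.smul_apply]
    ring
  add {X X'} hX hX' := by
    have e1 := dir_add (FDiffAt.inner (g := g) hX hZ) (FDiffAt.inner (g := g) hX' hZ) (Y x)
    have e2 := dir_add (FDiffAt.inner (g := g) hX hY) (FDiffAt.inner (g := g) hX' hY) (Z x)
    simp only [dir] at e1 e2
    simp only [koszul, Pi.add_apply, map_add, e1, e2,
      VectorField.mlieBracket_add_left hX hX', _root_.add_apply]
    ring

/-- By tensoriality in the first and last arguments, the extensions built into `nabla` may be
replaced by any differentiable fields with the same values at `x`. -/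
theorem inner_nabla (hX : DiffAt X x) (hY : DiffAt Y x) (hZ : DiffAt Z x) :
    g.inner x (nabla g (X x) Y) (Z x) = (1 / 2) * koszul g X Y Z x := by
  have h1 := tensorialAt_koszul_right (g := g) (diffAt_ext (X x)) hY
  rw [nabla, inner_sharp]
  · rw [h1.pointwise (diffAt_ext (Z x)) hZ (ext_apply_self _),
      (tensorialAt_koszul_left (g := g) hY hZ).pointwise (diffAt_ext (X x)) hX (ext_apply_self _)]
  · have := (((1 / 2 : ℝ)) • (TensorialAt.mkHom _ x h1 : T x →ₗ[ℝ] ℝ)).isLinear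
    exact this

theorem inner_nabla_vec (V W : T x) (hY : DiffAt Y x) :
    g.inner x (nabla g V Y) W = (1 / 2) * koszul g (ext V) Y (ext W) x := by
  have := inner_nabla (g := g) (diffAt_ext V) hY (diffAt_ext W)
  simpa only [ext_apply_self] using this

theorem nabla_isLinearMap (hY : DiffAt Y x) :
    IsLinearMap ℝ (fun V : T x => nabla g V Y) := by
  have key : ∀ W : T x, IsLinearMap ℝ (fun V : T x => g.inner x (nabla g V Y) W) := by
    intro W
    simp only [inner_nabla_vec _ _ hY]
    exact (((1 / 2 : ℝ)) • (TensorialAt.mkHom _ x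
      (tensorialAt_koszul_left (g := g) hY (diffAt_ext W)) : T x →ₗ[ℝ] ℝ)).isLinear
  constructor
  · intro A B
    refine g.eq_of_inner_eq fun W => ?_
    rw [(key W).map_add, map_add]; rfl
  · intro c A
    refine g.eq_of_inner_eq fun W => ?_
    rw [(key W).map_smul, map_smul]; rfl

theorem nabla_metric (V : T x) (hY : DiffAt Y x) (hZ : DiffAt Z x) :
    g.inner x (nabla g V Y) (Z x) + g.inner x (Y x) (nabla g V Z) =
      dir (fun y => g.inner y (Y y) (Z y)) V := by
  have h1 := inner_nabla (g := g) (diffAt_ext V) hY hZ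
  have h2 := inner_nabla (g := g) (diffAt_ext V) hZ hY
  have h3 := koszul_add_koszul_swap_right (g := g) (x := x) (X := ext V) (Y := Y) (Z := Z)
  rw [ext_apply_self] at h1 h2 h3
  rw [g.symm x (Y x), h1, h2]
  linarith

theorem nabla_torsion (hX : DiffAt X x) (hY : DiffAt Y x) :
    nabla g (X x) Y - nabla g (Y x) X = VectorField.mlieBracket (𝓡 4) X Y x := by
  refine g.eq_of_inner_eq fun W => ?_
  have h1 := inner_nabla (g := g) hX hY (diffAt_ext W)
  have h2 := inner_nabla (g := g) hY hX (diffAt_ext W)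
  have h3 := koszul_sub_koszul_swap (g := g) (x := x) (X := X) (Y := Y) (Z := ext W)
  rw [ext_apply_self] at h1 h2 h3
  rw [map_sub, _root_.sub_apply, h1, h2]
  linarith

end Koszul

/-! ### Local orthonormal frames -/

/-- `e` is an orthonormal frame field of class `C²` on the open set `O`. -/
structure IsLocalFrame (g : LorentzMetric M) (O : Set M) (e : Fin 4 → ∀ y : M, T y) : Prop where
  isOpen : IsOpen O
  smooth : ∀ y ∈ O, ∀ i, SmoothAt 2 (e i) y
  orthonormal : ∀ y ∈ O, g.IsOrthonormal (fun i => e i y)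

/-- The connection coefficients `g(∇_{e a} e b, e c)` of a frame field. -/
def connCoeff (g : LorentzMetric M) (e : Fin 4 → ∀ y : M, T y) (a b c : Fin 4) (y : M) : ℝ :=
  g.inner y (nabla g (e a y) (e b)) (e c y)

/-- The structure coefficients `g([e a, e b], e c)` of a frame field. -/
def structCoeff (g : LorentzMetric M) (e : Fin 4 → ∀ y : M, T y) (a b c : Fin 4) (y : M) : ℝ :=
  g.inner y (VectorField.mlieBracket (𝓡 4) (e a) (e b) y) (e c y)

omit [IsManifold (𝓡 4) ∞ M] in
theorem sum_smul_apply {ι : Type*} (s : Finset ι) (f : ι → M → ℝ) (e : ι → ∀ y : M, T y) (z : M) :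
    (∑ i ∈ s, f i • e i) z = ∑ i ∈ s, f i z • e i z :=
  Finset.sum_apply z s _

theorem isManifold_of_nat (n : ℕ) : IsManifold (𝓡 4) n M :=
  IsManifold.of_le (n := ∞) (by exact_mod_cast (le_top : (n : ℕ∞) ≤ ⊤))

namespace IsLocalFrame

variable {O : Set M} {e : Fin 4 → ∀ y : M, T y}

theorem diffAt (h : IsLocalFrame g O e) {y : M} (hy : y ∈ O) (i : Fin 4) : DiffAt (e i) y :=
  (h.smooth y hy i).mdifferentiableAt (by simp)

theorem mem_nhds (h : IsLocalFrame g O e) {y : M} (hy : y ∈ O) : O ∈ nhds y :=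
  h.isOpen.mem_nhds hy

theorem dir_eq_of_eqOn (h : IsLocalFrame g O e) {y : M} (hy : y ∈ O) {f f' : M → ℝ}
    (hf : ∀ z ∈ O, f z = f' z) (V : T y) : dir f V = dir f' V :=
  dir_congr (Filter.eventuallyEq_of_mem (h.mem_nhds hy) hf) V

theorem connCoeff_swap (h : IsLocalFrame g O e) {y : M} (hy : y ∈ O) (a b c : Fin 4) :
    connCoeff g e a b c y = -connCoeff g e a c b y := by
  have h1 := nabla_metric (g := g) (e a y) (h.diffAt hy b) (h.diffAt hy c)
  rw [h.dir_eq_of_eqOn hy (f' := fun _ => if b = c then sgn b else 0)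
    (fun z hz => h.orthonormal z hz b c), dir_const, g.symm y (e b y)] at h1
  exact eq_neg_of_add_eq_zero_left h1

theorem structCoeff_eq (h : IsLocalFrame g O e) {y : M} (hy : y ∈ O) (a b c : Fin 4) :
    structCoeff g e a b c y = connCoeff g e a b c y - connCoeff g e b a c y := by
  rw [structCoeff, ← nabla_torsion (g := g) (h.diffAt hy a) (h.diffAt hy b), map_sub]; rfl

/-- Koszul's formula in an orthonormal frame, where the scalar products are constant and only
brackets survive. -/
theorem connCoeff_eq (h : IsLocalFrame g O e) {y : M} (hy : y ∈ O) (a b c : Fin 4) :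
    connCoeff g e a b c y = (1 / 2) * (structCoeff g e a b c y - structCoeff g e a c b y
      - structCoeff g e b c a y) := by
  simp only [h.structCoeff_eq hy]
  have h1 := h.connCoeff_swap hy a b c
  have h2 := h.connCoeff_swap hy b a c
  have h3 := h.connCoeff_swap hy c a b
  linarith

theorem fdiffAt_structCoeff (h : IsLocalFrame g O e) {y : M} (hy : y ∈ O) (a b c : Fin 4) :
    FDiffAt (structCoeff g e a b c) y := by
  have i1 : IsManifold (𝓡 4) ((2 : ℕ∞) + 1) M := isManifold_of_nat (M := M) 3
  have i2 : IsManifold (𝓡 4) (minSmoothness ℝ 2) M := by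
    rw [minSmoothness_of_isRCLikeNormedField]; exact isManifold_of_nat (M := M) 2
  have h1 := ContMDiffAt.mlieBracket_vectorField (I := 𝓡 4) (m := 1) (n := 2)
    (h.smooth y hy a) (h.smooth y hy b) (by simp [minSmoothness_of_isRCLikeNormedField]; norm_num)
  exact FDiffAt.inner (h1.mdifferentiableAt (by simp)) (h.diffAt hy c)

/-- The extension used in `nabla` changes with the base point, so regularity is not visible from the
definition; it is read off from the brackets, which are of class `C¹` for a `C²` frame. -/
theorem fdiffAt_connCoeff (h : IsLocalFrame g O e) {y : M} (hy : y ∈ O) (a b c : Fin 4) :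
    FDiffAt (connCoeff g e a b c) y := by
  have h1 : FDiffAt (fun y => (1 / 2) * (structCoeff g e a b c y - structCoeff g e a c b y
      - structCoeff g e b c a y)) y :=
    mdifferentiableAt_const.mul (((h.fdiffAt_structCoeff hy a b c).sub
      (h.fdiffAt_structCoeff hy a c b)).sub (h.fdiffAt_structCoeff hy b c a))
  exact h1.congr_of_eventuallyEq
    (Filter.eventuallyEq_of_mem (h.mem_nhds hy) fun z hz => h.connCoeff_eq hz a b c)

theorem inner_mlieBracket_mlieBracket (h : IsLocalFrame g O e) {y : M} (hy : y ∈ O)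
    (a b c d : Fin 4) :
    g.inner y (VectorField.mlieBracket (𝓡 4) (e a) (VectorField.mlieBracket (𝓡 4) (e b) (e c)) y)
      (e d y) = dir (structCoeff g e b c d) (e a y) +
        ∑ f, sgn f * structCoeff g e b c f y * structCoeff g e a f d y := by
  have h0 : ∀ z ∈ O, VectorField.mlieBracket (𝓡 4) (e b) (e c) z =
      ∑ f, (sgn f * structCoeff g e b c f z) • e f z := fun z hz => by
    conv_lhs => rw [(h.orthonormal z hz).expand (VectorField.mlieBracket (𝓡 4) (e b) (e c) z)]
    simp only [structCoeff, g.symm z (e _ z)]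
  have h1 : VectorField.mlieBracket (𝓡 4) (e b) (e c) =ᶠ[nhds y]
      (∑ f, (fun z => sgn f * structCoeff g e b c f z) • e f : ∀ z : M, T z) :=
    Filter.eventuallyEq_of_mem (h.mem_nhds hy) fun z hz =>
      (h0 z hz).trans (sum_smul_apply Finset.univ
        (fun f z => sgn f * structCoeff g e b c f z) e z).symm
  have h3 : VectorField.mlieBracket (𝓡 4) (e a) (VectorField.mlieBracket (𝓡 4) (e b) (e c)) y =
      VectorField.mlieBracket (𝓡 4) (e a)
        (∑ f, (fun z => sgn f * structCoeff g e b c f z) • e f) y :=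
    Filter.EventuallyEq.mlieBracket_vectorField_eq (Filter.EventuallyEq.refl _ _) h1
  rw [h3, mlieBracket_sum_smul_right Finset.univ
      (f := fun f z => sgn f * structCoeff g e b c f z)
      (fun f _ => mdifferentiableAt_const.mul (h.fdiffAt_structCoeff hy b c f))
      (fun f _ => h.diffAt hy f)]
  have h2 : ∀ f, dir (fun z => sgn f * structCoeff g e b c f z) (e a y) =
      sgn f * dir (structCoeff g e b c f) (e a y) := fun f =>
    dir_const_mul _ (h.fdiffAt_structCoeff hy b c f) _
  simp only [h2, map_sum, map_add, map_smul, _root_.sum_apply, _root_.add_apply, _root_.smul_apply,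
    smul_eq_mul, Finset.sum_add_distrib, h.orthonormal y hy _ d]
  congr 1
  simp [mul_right_comm, sgn_mul_self]

/-- The Jacobi identity for the structure coefficients of a frame. -/
theorem jacobi (h : IsLocalFrame g O e) {y : M} (hy : y ∈ O) (a b c d : Fin 4) :
    (dir (structCoeff g e b c d) (e a y) - dir (structCoeff g e a c d) (e b y)
      + dir (structCoeff g e a b d) (e c y))
    + ∑ f, sgn f * (structCoeff g e b c f y * structCoeff g e a f d y
      - structCoeff g e a c f y * structCoeff g e b f d y
      + structCoeff g e a b f y * structCoeff g e c f d y) = 0 := by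
  have i1 : IsManifold (𝓡 4) (minSmoothness ℝ 3) M := by
    rw [minSmoothness_of_isRCLikeNormedField]; exact isManifold_of_nat (M := M) 3
  have h2 : minSmoothness ℝ 2 = 2 := minSmoothness_of_isRCLikeNormedField
  have h1 := VectorField.leibniz_identity_mlieBracket_apply (I := 𝓡 4) (U := e a) (V := e b)
    (W := e c) (x := y) (by rw [h2]; exact h.smooth y hy a) (by rw [h2]; exact h.smooth y hy b)
    (by rw [h2]; exact h.smooth y hy c)
  -- Replacing `[[e a, e b], e c]` by `-[e c, [e a, e b]]` gives all three double brackets the shape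
  -- of `inner_mlieBracket_mlieBracket`.
  rw [VectorField.mlieBracket_swap_apply (W := e c)] at h1
  have h3 := congrArg (fun V => g.inner y V (e d y)) h1
  simp only [map_add, map_neg, _root_.add_apply, _root_.neg_apply,
    h.inner_mlieBracket_mlieBracket hy] at h3
  simp only [mul_add, mul_sub, Finset.sum_add_distrib, Finset.sum_sub_distrib, ← mul_assoc]
  linarith

end IsLocalFrame

/-! ### Decomposable 2-forms -/

/-- The 2-form `c θ_p ∧ θ_q` of a frame field, where `θ_i` is the 1-form equivalent to `e i`. -/
def wedge (g : LorentzMetric M) (e : Fin 4 → ∀ y : M, T y) (c : ℝ) (p q : Fin 4) : Tensor2 M :=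
  fun y X Y => c * (g.inner y (e p y) X * g.inner y (e q y) Y
    - g.inner y (e p y) Y * g.inner y (e q y) X)

/-- The 1-form `α` contracted with `c θ_p ∧ θ_q`. -/
theorem wedge_sharp (e : Fin 4 → ∀ y : M, T y) (c : ℝ) (p q : Fin 4) {y : M} {α : T y → ℝ}
    (hα : IsLinearMap ℝ α) (X : T y) :
    wedge g e c p q y X (sharp g y α) =
      c * (g.inner y (e p y) X * α (e q y) - α (e p y) * g.inner y (e q y) X) := by
  rw [wedge, g.symm y (e p y) (sharp g y α), g.symm y (e q y) (sharp g y α), inner_sharp hα,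
    inner_sharp hα]

/-- The metric components in an orthonormal frame. -/
def eta (i j : Fin 4) : ℝ := if i = j then sgn i else 0

/-- `P` is on `O` the projector on the span of the `e i` with `i ∈ A`. -/
def IsFrameProjector (g : LorentzMetric M) (O : Set M) (e : Fin 4 → ∀ y : M, T y)
    (A : Finset (Fin 4)) (P : EndField M) : Prop :=
  ∀ y ∈ O, ∀ X : T y, P y X = ∑ i ∈ A, (sgn i * g.inner y (e i y) X) • e i y

namespace IsLocalFrame

variable {O : Set M} {e : Fin 4 → ∀ y : M, T y}

/-- In the product rule, the derivatives of the extensions of `Y` and `Z` are those that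
`nablaTensor` subtracts, so only `∇ e_p` and `∇ e_q` remain. -/
theorem nablaTensor_wedge (h : IsLocalFrame g O e) {B : Tensor2 M} {c : ℝ} {p q : Fin 4}
    (hB : ∀ y ∈ O, B y = wedge g e c p q y) {y : M} (hy : y ∈ O) (X Y Z : T y) :
    nablaTensor g B y X Y Z =
      c * ((g.inner y (nabla g X (e p)) Y * g.inner y (e q y) Z
          + g.inner y (e p y) Y * g.inner y (nabla g X (e q)) Z)
        - (g.inner y (nabla g X (e p)) Z * g.inner y (e q y) Y
          + g.inner y (e p y) Z * g.inner y (nabla g X (e q)) Y)) := by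
  have hd : ∀ i (V : T y), FDiffAt (fun z => g.inner z (e i z) (ext V z)) y := fun i V =>
    FDiffAt.inner (h.diffAt hy i) (diffAt_ext V)
  have hm : ∀ i (V : T y), dir (fun z => g.inner z (e i z) (ext V z)) X =
      g.inner y (nabla g X (e i)) V + g.inner y (e i y) (nabla g X (ext V)) := fun i V => by
    rw [← nabla_metric X (h.diffAt hy i) (diffAt_ext V), ext_apply_self]
  have hBe : ∀ z ∈ O, B z (ext Y z) (ext Z z) =
      c * (g.inner z (e p z) (ext Y z) * g.inner z (e q z) (ext Z z)
        + -1 * (g.inner z (e p z) (ext Z z) * g.inner z (e q z) (ext Y z))) := fun z hz => by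
    rw [hB z hz, wedge]; ring
  have h1 := h.dir_eq_of_eqOn hy hBe X
  rw [dir_const_mul, dir_add, dir_const_mul, dir_mul (hd _ _) (hd _ _),
    dir_mul (hd _ _) (hd _ _)] at h1
  · simp only [hm, ext_apply_self] at h1
    rw [nablaTensor, hB y hy]
    refine (congrArg (fun r => r - _ - _) h1).trans ?_
    simp only [wedge]
    ring
  · exact (hd _ _).mul (hd _ _)
  · exact (hd _ _).mul (hd _ _)
  · exact mdifferentiableAt_const.mul ((hd _ _).mul (hd _ _))
  · exact ((hd _ _).mul (hd _ _)).add (mdifferentiableAt_const.mul ((hd _ _).mul (hd _ _)))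

theorem codiff_wedge_vec (h : IsLocalFrame g O e) {B : Tensor2 M} {c : ℝ} {p q : Fin 4}
    (hB : ∀ y ∈ O, B y = wedge g e c p q y) {y : M} (hy : y ∈ O) (Z : T y) :
    codiff g B y Z = -∑ a, sgn a * nablaTensor g B y (e a y) (e a y) Z := by
  have hp := nabla_isLinearMap (g := g) (h.diffAt hy p)
  have hq := nabla_isLinearMap (g := g) (h.diffAt hy q)
  have hbil : IsBilinearMap ℝ (fun X Y : T y => nablaTensor g B y X Y Z) := by
    simp only [h.nablaTensor_wedge hB hy]
    constructor <;> intros <;>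
      simp only [hp.map_add, hq.map_add, hp.map_smul, hq.map_smul, map_add, map_smul, smul_eq_mul,
        _root_.add_apply, _root_.smul_apply] <;> ring
  rw [codiff, (h.orthonormal y hy).trace_eq hbil]
  simp only [smul_eq_mul]

theorem isLinearMap_codiff_wedge (h : IsLocalFrame g O e) {B : Tensor2 M} {c : ℝ} {p q : Fin 4}
    (hB : ∀ y ∈ O, B y = wedge g e c p q y) {y : M} (hy : y ∈ O) :
    IsLinearMap ℝ (codiff g B y) := by
  constructor
  · intro X Y
    simp only [h.codiff_wedge_vec hB hy, ← neg_add, ← Finset.sum_add_distrib,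
      h.nablaTensor_wedge hB hy, map_add]
    congr 1
    exact Finset.sum_congr rfl fun _ _ => by ring
  · intro r X
    simp only [h.codiff_wedge_vec hB hy, smul_eq_mul, mul_neg, Finset.mul_sum,
      h.nablaTensor_wedge hB hy, map_smul]
    congr 1
    exact Finset.sum_congr rfl fun _ _ => by ring

theorem codiff_wedge (h : IsLocalFrame g O e) {B : Tensor2 M} {c : ℝ} {p q : Fin 4}
    (hB : ∀ y ∈ O, B y = wedge g e c p q y) {y : M} (hy : y ∈ O) (b : Fin 4) :
    codiff g B y (e b y) = -∑ a, sgn a * (c *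
      ((connCoeff g e a p a y * eta q b + eta p a * connCoeff g e a q b y)
        - (connCoeff g e a p b y * eta q a + eta p b * connCoeff g e a q a y))) := by
  have ho : ∀ i j, g.inner y (e i y) (e j y) = eta i j := h.orthonormal y hy
  simp only [h.codiff_wedge_vec hB hy, h.nablaTensor_wedge hB hy, ho, connCoeff]

/-! ### Second fundamental forms -/

variable {A : Finset (Fin 4)} {P : EndField M}

theorem inner_projector (h : IsLocalFrame g O e) (hP : IsFrameProjector g O e A P) {y : M}
    (hy : y ∈ O) (X : T y) (c : Fin 4) :
    g.inner y (P y X) (e c y) = if c ∈ A then g.inner y (e c y) X else 0 := by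
  have ho : ∀ i j, g.inner y (e i y) (e j y) = if i = j then sgn i else 0 := h.orthonormal y hy
  rw [hP y hy]
  simp only [map_sum, map_smul, _root_.sum_apply, _root_.smul_apply, smul_eq_mul, ho, mul_ite,
    mul_zero, Finset.sum_ite_eq', mul_right_comm, sgn_mul_self, one_mul]

theorem projector_frame (h : IsLocalFrame g O e) (hP : IsFrameProjector g O e A P) {y : M}
    (hy : y ∈ O) (a : Fin 4) : P y (e a y) = if a ∈ A then e a y else 0 := by
  have ho : ∀ i j, g.inner y (e i y) (e j y) = if i = j then sgn i else 0 := h.orthonormal y hy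
  rw [hP y hy]
  simp only [ho, mul_ite, mul_zero, sgn_mul_self, ite_smul, one_smul, zero_smul,
    Finset.sum_ite_eq']

theorem diffAt_projector (h : IsLocalFrame g O e) (hP : IsFrameProjector g O e A P) {y : M}
    (hy : y ∈ O) {X : ∀ z : M, T z} (hX : DiffAt X y) : DiffAt (fun z => P z (X z)) y := by
  have h1 : DiffAt (∑ i ∈ A, (fun z => sgn i * g.inner z (e i z) (X z)) • e i) y :=
    DiffAt.sum fun i _ => (h.diffAt hy i).smul
      (mdifferentiableAt_const.mul (FDiffAt.inner (h.diffAt hy i) hX))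
  refine MDifferentiableAt.congr_of_eventuallyEq h1
    (Filter.eventuallyEq_of_mem (h.mem_nhds hy) fun z hz => ?_)
  have := (hP z hz (X z)).trans
    (sum_smul_apply A (fun i z => sgn i * g.inner z (e i z) (X z)) e z).symm
  simp only [this]

/-- Near `y` the field `P (ext (e b y))` is orthogonal to `e c`, so its derivative can be moved onto
`e c`. Only its value at `y` then matters. -/
theorem inner_secondForm (h : IsLocalFrame g O e) (hP : IsFrameProjector g O e A P) {y : M}
    (hy : y ∈ O) (a b : Fin 4) {c : Fin 4} (hc : c ∉ A) :
    g.inner y (secondForm g P y (e a y) (e b y)) (e c y) =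
      if a ∈ A ∧ b ∈ A then connCoeff g e a b c y else 0 := by
  have hd := h.diffAt_projector hP hy (diffAt_ext (e b y))
  have h1 := nabla_metric (g := g) (P y (e a y)) hd (h.diffAt hy c)
  rw [h.dir_eq_of_eqOn hy (f' := fun _ => 0)
    (fun z hz => by rw [h.inner_projector hP hz, if_neg hc]), dir_const, ext_apply_self] at h1
  rw [secondForm, map_sub, _root_.sub_apply, h.inner_projector hP hy, if_neg hc, sub_zero,
    eq_neg_of_add_eq_zero_left h1, h.projector_frame hP hy, h.projector_frame hP hy]
  have hn := nabla_isLinearMap (g := g) (h.diffAt hy c)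
  by_cases ha : a ∈ A <;> by_cases hb : b ∈ A
  · simp only [ha, hb, if_true, and_self]
    rw [g.symm, h.connCoeff_swap hy]; rfl
  all_goals simp [ha, hb, hn.map_zero]

theorem umbilical_relation (h : IsLocalFrame g O e) (hP : IsFrameProjector g O e A P)
    (hu : IsUmbilicalPlane g P) {y : M} (hy : y ∈ O) {c : Fin 4} (hc : c ∉ A) :
    ∃ r : ℝ, ∀ a ∈ A, ∀ b ∈ A, connCoeff g e a b c y + connCoeff g e b a c y = eta a b * r := by
  -- The constant is the `e c` component of `tr S_P`; the factor 1/2 in the symmetrization cancels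
  -- the one in the umbilical condition.
  refine ⟨g.inner y (trace g y (symSecondForm g P y)) (e c y), fun a ha b hb => ?_⟩
  have h1 := congrArg (fun V => g.inner y V (e c y)) (hu y (e a y) (e b y))
  have ho : g.inner y (e a y) (e b y) = eta a b := h.orthonormal y hy a b
  simp only [symSecondForm, map_smul, map_add, _root_.smul_apply, _root_.add_apply, smul_eq_mul,
    h.inner_secondForm hP hy _ _ hc, h.projector_frame hP hy, ha, hb, and_self, if_true] at h1
  rw [ho] at h1
  linarith [h1]

end IsLocalFrame

/-- The Lie derivative of the metric in terms of the Levi-Civita connection. -/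
theorem lieDeriv_metric {W : ∀ y : M, T y} {y : M} (hW : DiffAt W y) (X Y : T y) :
    lieDeriv W g.tensor y X Y = g.inner y (nabla g X W) Y + g.inner y X (nabla g Y W) := by
  have hX := diffAt_ext X
  have hY := diffAt_ext Y
  have h1 := nabla_metric (g := g) (W y) hX hY
  have h2 := nabla_torsion (g := g) hW hX
  have h3 := nabla_torsion (g := g) hW hY
  simp only [ext_apply_self] at h1 h2 h3
  rw [lieDeriv, ← h2, ← h3]
  simp only [LorentzMetric.tensor, map_sub, _root_.sub_apply]
  simp only [dir] at h1
  rw [← h1]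
  ring

/-! ### The Hodge dual of a decomposable 2-form -/

theorem volume_swap_pairs {V : Type*} [AddCommGroup V] [Module ℝ V]
    (f : V [⋀^Fin 4]→ₗ[ℝ] ℝ) (X Y Z W : V) : f ![X, Y, Z, W] = f ![Z, W, X, Y] := by
  have h := f.map_perm ![Z, W, X, Y] (Equiv.swap 0 2 * Equiv.swap 1 3)
  have h2 : ![Z, W, X, Y] ∘ (Equiv.swap 0 2 * Equiv.swap 1 3 : Equiv.Perm (Fin 4)) =
      ![X, Y, Z, W] := by
    ext i; fin_cases i <;> rfl
  have h3 : Equiv.Perm.sign (Equiv.swap 0 2 * Equiv.swap 1 3 : Equiv.Perm (Fin 4)) = 1 := by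
    decide
  rw [h2, h3, one_smul] at h
  exact h

theorem isBilinearMap_volume {V : Type*} [AddCommGroup V] [Module ℝ V]
    (f : V [⋀^Fin 4]→ₗ[ℝ] ℝ) (Z W : V) : IsBilinearMap ℝ (fun X Y => f ![X, Y, Z, W]) := by
  have h : (fun X Y => f ![X, Y, Z, W]) = fun X Y => (f.curryLeft X).curryLeft Y ![Z, W] := rfl
  rw [h]
  constructor <;> intros <;> simp

theorem volume_swap_left {V : Type*} [AddCommGroup V] [Module ℝ V]
    (f : V [⋀^Fin 4]→ₗ[ℝ] ℝ) (X Y Z W : V) : f ![Y, X, Z, W] = -f ![X, Y, Z, W] := by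
  have h := f.map_swap ![X, Y, Z, W] (i := 0) (j := 1) (by decide)
  have h2 : ![X, Y, Z, W] ∘ (Equiv.swap 0 1 : Equiv.Perm (Fin 4)) = ![Y, X, Z, W] := by
    ext i; fin_cases i <;> rfl
  rw [h2] at h
  exact h

theorem volume_eq_zero {V : Type*} [AddCommGroup V] [Module ℝ V]
    (f : V [⋀^Fin 4]→ₗ[ℝ] ℝ) {v : Fin 4 → V} (i j : Fin 4) (h : v i = v j) (hij : i ≠ j) :
    f v = 0 := f.map_eq_zero_of_eq v h hij

/-- With `e 0` and `e 1` already inserted, only the components along `e 2` and `e 3` survive. Moving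
the pair `e 0`, `e 1` to the front is an even permutation, so no sign appears. -/
theorem volume_pair {x : M} {e : Fin 4 → T x} (he : g.IsOrthonormal e)
    (f : (T x) [⋀^Fin 4]→ₗ[ℝ] ℝ) (X Y : T x) :
    f ![X, Y, e 0, e 1] = f e * (g.inner x (e 2) X * g.inner x (e 3) Y
      - g.inner x (e 2) Y * g.inner x (e 3) X) := by
  have hb := isBilinearMap_volume f (e 0) (e 1)
  obtain ⟨L, hL⟩ : ∃ L : T x →ₗ[ℝ] T x →ₗ[ℝ] ℝ, ∀ X Y, f ![X, Y, e 0, e 1] = L X Y :=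
    ⟨hb.toLinearMap, fun _ _ => rfl⟩
  have hz : ∀ a b : Fin 4, (a = 0 ∨ a = 1 ∨ b = 0 ∨ b = 1 ∨ a = b) → L (e a) (e b) = 0 := by
    intro a b hab
    rw [← hL]
    rcases hab with rfl | rfl | rfl | rfl | rfl
    · exact volume_eq_zero f 0 2 rfl (by decide)
    · exact volume_eq_zero f 0 3 rfl (by decide)
    · exact volume_eq_zero f 1 2 rfl (by decide)
    · exact volume_eq_zero f 1 3 rfl (by decide)
    · exact volume_eq_zero f 0 1 rfl (by decide)
  have h23 : L (e 2) (e 3) = f e := by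
    rw [← hL, volume_swap_pairs]
    congr 1
    ext i; fin_cases i <;> rfl
  have h32 : L (e 3) (e 2) = -f e := by
    rw [← hL, volume_swap_left, hL, h23]
  rw [hL, he.expand X, he.expand Y]
  simp only [Fin.sum_univ_four]
  simp [hz, h23, h32, he _ _, sgn]
  ring

/-- The two orders of the pair `e 0`, `e 1` contribute equally and absorb the factor 1/2. -/
theorem hodge_wedge (η : VolumeElement g) {x : M} {e : Fin 4 → ∀ y : M, T y} {c : ℝ}
    (X Y : T x) {F : Tensor2 M}
    (hF : F x = wedge g e c 0 1 x) :
    hodge g η F x X Y = c * η.form x ![X, Y, e 0 x, e 1 x] := by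
  have hb := isBilinearMap_volume (η.form x) X Y
  obtain ⟨L, hL⟩ : ∃ L : T x →ₗ[ℝ] T x →ₗ[ℝ] ℝ, ∀ Z W, η.form x ![X, Y, Z, W] = L Z W :=
    ⟨hb.toLinearMap, fun Z W => volume_swap_pairs (η.form x) X Y Z W⟩
  have hf := g.frame_isOrthonormal x
  have h1 : ∀ p q, ∑ i, ∑ j, sgn i * sgn j * L (g.frame x i) (g.frame x j) *
      (g.inner x (e p x) (g.frame x i) * g.inner x (e q x) (g.frame x j)) = L (e p x) (e q x) := by
    intro p q
    conv_rhs => rw [hf.expand (e p x), hf.expand (e q x)]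
    simp only [map_sum, map_smul, LinearMap.sum_apply, LinearMap.smul_apply, smul_eq_mul,
      g.symm x (g.frame x _), Finset.mul_sum]
    rw [Finset.sum_comm]
    exact Finset.sum_congr rfl fun i _ => Finset.sum_congr rfl fun j _ => by ring
  have h2 : L (e 1 x) (e 0 x) = - L (e 0 x) (e 1 x) := by
    rw [← hL, ← hL, volume_swap_pairs (η.form x), volume_swap_left (η.form x),
      volume_swap_pairs (η.form x) (e 0 x)]
  have h3 : hodge g η F x X Y = (1 / 2) * (c * (L (e 0 x) (e 1 x) - L (e 1 x) (e 0 x))) := by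
    rw [hodge]
    congr 1
    rw [← h1 0 1, ← h1 1 0, ← Finset.sum_sub_distrib, Finset.mul_sum]
    refine Finset.sum_congr rfl fun i _ => ?_
    rw [← Finset.sum_sub_distrib, Finset.mul_sum]
    refine Finset.sum_congr rfl fun j _ => ?_
    rw [hL, hF, wedge]
    ring
  rw [h3, h2, ← hL]
  ring

/-! ### Adapted frames -/

/-- `e` is an orthonormal frame adapted to the structure: `U = θ_0 ∧ θ_1`, and the volume element
takes the constant value `t` on it. -/
structure IsAdaptedFrame (S : Structure22 g) (η : VolumeElement g) (O : Set M)
    (e : Fin 4 → ∀ y : M, T y) (t : ℝ) : Prop extends IsLocalFrame g O e where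
  form_eq : ∀ y ∈ O, S.form y = wedge g e 1 0 1 y
  volume_eq : ∀ y ∈ O, η.form y (fun i => e i y) = t

/-- The components of the rotation 1-form. of an adapted frame, in terms of the structure
coefficients. -/
def rotationCoeff (g : LorentzMetric M) (e : Fin 4 → ∀ y : M, T y) (t : ℝ) :
    Fin 4 → M → ℝ :=
  ![fun y => t * structCoeff g e 2 3 1 y, fun y => t * structCoeff g e 2 3 0 y,
    fun y => -t * structCoeff g e 0 1 3 y, fun y => t * structCoeff g e 0 1 2 y]

/-- The components of the expansion 1-form. in an adapted frame with connection coefficients `G`. -/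
def expansionCoeff (G : Fin 4 → Fin 4 → Fin 4 → ℝ) : Fin 4 → ℝ :=
  ![-G 2 0 2 - G 3 0 3, -G 2 1 2 - G 3 1 3, G 0 2 0 - G 1 2 1, G 0 3 0 - G 1 3 1]

namespace IsAdaptedFrame

variable {S : Structure22 g} {η : VolumeElement g} {O : Set M} {e : Fin 4 → ∀ y : M, T y} {t : ℝ}

theorem hodge_eq (h : IsAdaptedFrame S η O e t) {y : M} (hy : y ∈ O) :
    hodge g η S.form y = wedge g e t 2 3 y := by
  ext X Y
  rw [hodge_wedge η X Y (h.form_eq y hy),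
    volume_pair (h.orthonormal y hy) (η.form y) X Y, h.volume_eq y hy, one_mul]
  rfl

theorem sq_eq_one (h : IsAdaptedFrame S η O e t) {y : M} (hy : y ∈ O) : t ^ 2 = 1 := by
  rw [← h.volume_eq y hy]; exact η.normalized y _ (h.orthonormal y hy)

theorem toEnd_eq (h : IsAdaptedFrame S η O e t) {y : M} (hy : y ∈ O) (X : T y) :
    toEnd g S.form y X = g.inner y (e 0 y) X • e 1 y - g.inner y (e 1 y) X • e 0 y := by
  refine g.eq_of_inner_eq fun Z => ?_
  have hl : IsLinearMap ℝ (S.form y X) := (S.U y X : T y →ₗ[ℝ] ℝ).isLinear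
  rw [toEnd, inner_sharp hl, h.form_eq y hy, wedge]
  simp only [map_sub, map_smul, _root_.sub_apply, _root_.smul_apply, smul_eq_mul]
  ring

theorem v_eq (h : IsAdaptedFrame S η O e t) : IsFrameProjector g O e {0, 1} S.v := by
  intro y hy X
  have ho : ∀ i j, g.inner y (e i y) (e j y) = if i = j then sgn i else 0 := h.orthonormal y hy
  rw [Finset.sum_pair (by decide), Structure22.v, h.toEnd_eq hy, h.toEnd_eq hy]
  simp only [map_sub, map_smul, smul_eq_mul, ho]
  simp [sgn]
  abel

theorem h_eq (h : IsAdaptedFrame S η O e t) : IsFrameProjector g O e {2, 3} S.h := by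
  intro y hy X
  rw [Finset.sum_pair (by decide), Structure22.h, h.v_eq y hy, Finset.sum_pair (by decide)]
  have := (h.orthonormal y hy).expand X
  rw [Fin.sum_univ_four] at this
  rw [sub_eq_iff_eq_add]
  refine this.trans ?_
  abel

theorem expansion_eq (h : IsAdaptedFrame S η O e t) {y : M} (hy : y ∈ O) (X : T y) :
    S.expansion η y X =
      t * (g.inner y (e 2 y) X * codiff g (hodge g η S.form) y (e 3 y)
        - codiff g (hodge g η S.form) y (e 2 y) * g.inner y (e 3 y) X)
      - 1 * (g.inner y (e 0 y) X * codiff g S.form y (e 1 y)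
        - codiff g S.form y (e 0 y) * g.inner y (e 1 y) X) := by
  have h1 := h.isLinearMap_codiff_wedge h.form_eq hy
  have h2 := h.isLinearMap_codiff_wedge (fun y hy => h.hodge_eq hy) hy
  rw [← wedge_sharp e _ _ _ h2, ← wedge_sharp e _ _ _ h1, ← h.hodge_eq hy, ← h.form_eq y hy]
  rfl

theorem rotation_eq (h : IsAdaptedFrame S η O e t) {y : M} (hy : y ∈ O) (X : T y) :
    S.rotation η y X =
      t * (g.inner y (e 2 y) X * codiff g S.form y (e 3 y)
        - codiff g S.form y (e 2 y) * g.inner y (e 3 y) X)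
      + 1 * (g.inner y (e 0 y) X * codiff g (hodge g η S.form) y (e 1 y)
        - codiff g (hodge g η S.form) y (e 0 y) * g.inner y (e 1 y) X) := by
  have h1 := h.isLinearMap_codiff_wedge h.form_eq hy
  have h2 := h.isLinearMap_codiff_wedge (fun y hy => h.hodge_eq hy) hy
  rw [← wedge_sharp e _ _ _ h2, ← wedge_sharp e _ _ _ h1, ← h.hodge_eq hy, ← h.form_eq y hy]
  rfl

theorem isLinearMap_expansion (h : IsAdaptedFrame S η O e t) {y : M} (hy : y ∈ O) :
    IsLinearMap ℝ (S.expansion η y) := by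
  constructor <;> intros <;> simp only [h.expansion_eq hy, map_add, map_smul, smul_eq_mul] <;> ring

theorem isLinearMap_rotation (h : IsAdaptedFrame S η O e t) {y : M} (hy : y ∈ O) :
    IsLinearMap ℝ (S.rotation η y) := by
  constructor <;> intros <;> simp only [h.rotation_eq hy, map_add, map_smul, smul_eq_mul] <;> ring

/-- In each component the connection coefficients pair up into that of a bracket of two vectors of
the same plane. Umbilicity plays no part. -/
theorem rotation_frame (h : IsAdaptedFrame S η O e t) {y : M} (hy : y ∈ O) (b : Fin 4) :
    S.rotation η y (e b y) = rotationCoeff g e t b y := by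
  have ho : ∀ i j, g.inner y (e i y) (e j y) = if i = j then sgn i else 0 := h.orthonormal y hy
  rw [h.rotation_eq hy]
  simp only [h.codiff_wedge h.form_eq hy, h.codiff_wedge (fun y hy => h.hodge_eq hy) hy, ho,
    Fin.sum_univ_four]
  fin_cases b <;> simp [rotationCoeff, eta, sgn, h.structCoeff_eq hy, -mul_eq_mul_left_iff] <;> ring

theorem fdiffAt_rotationCoeff (h : IsAdaptedFrame S η O e t) {y : M} (hy : y ∈ O) (b : Fin 4) :
    FDiffAt (rotationCoeff g e t b) y := by
  fin_cases b <;> exact mdifferentiableAt_const.mul (h.fdiffAt_structCoeff hy _ _ _)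

/-- Since `G_abc = -G_acb`, these are the components of `tr Q_h` along `V` and of `tr Q_v` along
`H`. The components along `H` carry `t` twice, once from each `*U`, hence the use of `t ^ 2 = 1`. -/
theorem expansion_frame (h : IsAdaptedFrame S η O e t) {y : M} (hy : y ∈ O) (b : Fin 4) :
    S.expansion η y (e b y) = expansionCoeff (fun a b c => connCoeff g e a b c y) b := by
  have ho : ∀ i j, g.inner y (e i y) (e j y) = if i = j then sgn i else 0 := h.orthonormal y hy
  rw [h.expansion_eq hy]
  simp only [h.codiff_wedge h.form_eq hy, h.codiff_wedge (fun y hy => h.hodge_eq hy) hy, ho,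
    Fin.sum_univ_four]
  have ht := h.sq_eq_one hy
  have hz : ∀ a b, connCoeff g e a b b y = 0 := fun a b => by
    linarith [h.connCoeff_swap hy a b b]
  fin_cases b <;> simp [expansionCoeff, eta, sgn, hz]
  · ring
  · ring
  · linear_combination (connCoeff g e 0 2 0 y - connCoeff g e 1 2 1 y) * ht
  · linear_combination (connCoeff g e 0 3 0 y - connCoeff g e 1 3 1 y) * ht

/-- Written in the local frame, the field has structure coefficients as components, and these are
differentiable. -/
theorem diffAt_sharp_rotation (h : IsAdaptedFrame S η O e t) {y : M} (hy : y ∈ O) :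
    DiffAt (sharpField g (S.rotation η)) y := by
  have h1 : DiffAt (∑ i, (fun z => sgn i * rotationCoeff g e t i z) • e i) y :=
    DiffAt.sum fun i _ => (h.diffAt hy i).smul
      (mdifferentiableAt_const.mul (h.fdiffAt_rotationCoeff hy i))
  refine MDifferentiableAt.congr_of_eventuallyEq h1
    (Filter.eventuallyEq_of_mem (h.mem_nhds hy) fun z hz => ?_)
  have h2 := (h.orthonormal z hz).sharp_eq (h.isLinearMap_rotation hz)
  simp only [h.rotation_frame hz] at h2
  have := h2.trans
    (sum_smul_apply Finset.univ (fun i z => sgn i * rotationCoeff g e t i z) e z).symm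
  simp only [sharpField, this]

theorem N_eq (h : IsAdaptedFrame S η O e t) {y : M} (hy : y ∈ O) (X Y : T y) :
    S.N η y X Y = g.inner y (nabla g X (sharpField g (S.rotation η))) Y
      + g.inner y X (nabla g Y (sharpField g (S.rotation η)))
      - (S.expansion η y X * S.rotation η y Y + S.rotation η y X * S.expansion η y Y) := by
  rw [← lieDeriv_metric (h.diffAt_sharp_rotation hy)]; rfl

theorem isBilinearMap_N (h : IsAdaptedFrame S η O e t) {y : M} (hy : y ∈ O) :
    IsBilinearMap ℝ (S.N η y) := by
  have h1 := h.isLinearMap_rotation hy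
  have h2 := h.isLinearMap_expansion hy
  have h3 := nabla_isLinearMap (g := g) (h.diffAt_sharp_rotation hy)
  constructor <;> intros <;>
    simp only [h.N_eq hy, h1.map_add, h2.map_add, h3.map_add, h1.map_smul, h2.map_smul,
      h3.map_smul, map_add, map_smul, smul_eq_mul, _root_.add_apply, _root_.smul_apply] <;> ring

theorem inner_nabla_rotation (h : IsAdaptedFrame S η O e t) {y : M} (hy : y ∈ O) (a b : Fin 4) :
    g.inner y (nabla g (e a y) (sharpField g (S.rotation η))) (e b y) =
      dir (rotationCoeff g e t b) (e a y) -
        ∑ d, sgn d * rotationCoeff g e t d y * connCoeff g e a b d y := by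
  have h1 := nabla_metric (g := g) (e a y) (h.diffAt_sharp_rotation hy) (h.diffAt hy b)
  have h2 : ∀ z ∈ O, ∀ i, g.inner z (sharpField g (S.rotation η) z) (e i z) =
      rotationCoeff g e t i z := fun z hz i => by
    rw [sharpField, inner_sharp (h.isLinearMap_rotation hz), h.rotation_frame hz]
  rw [h.dir_eq_of_eqOn hy (fun z hz => h2 z hz b), (h.orthonormal y hy).inner_expand
    (sharpField g (S.rotation η) y)] at h1
  simp only [h2 y hy] at h1
  exact eq_sub_of_add_eq h1

theorem N_frame (h : IsAdaptedFrame S η O e t) {y : M} (hy : y ∈ O) (a b : Fin 4) :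
    S.N η y (e a y) (e b y) =
      (dir (rotationCoeff g e t b) (e a y) -
        ∑ d, sgn d * rotationCoeff g e t d y * connCoeff g e a b d y)
      + (dir (rotationCoeff g e t a) (e b y) -
        ∑ d, sgn d * rotationCoeff g e t d y * connCoeff g e b a d y)
      - (expansionCoeff (fun a b c => connCoeff g e a b c y) a * rotationCoeff g e t b y
        + rotationCoeff g e t a y * expansionCoeff (fun a b c => connCoeff g e a b c y) b) := by
  rw [h.N_eq hy, h.inner_nabla_rotation hy, g.symm y (e a y), h.inner_nabla_rotation hy,
    h.rotation_frame hy, h.rotation_frame hy, h.expansion_frame hy, h.expansion_frame hy]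

end IsAdaptedFrame

/-! ### The umbilical relations in an adapted frame -/

/-- The linear relations between the connection coefficients of an orthonormal frame adapted to an
umbilical structure. -/
structure UmbilicalRelations (G : Fin 4 → Fin 4 → Fin 4 → ℝ) : Prop where
  swap : ∀ a b c, G a b c = -G a c b
  v_diag : ∀ c, 2 ≤ c → G 1 1 c = -G 0 0 c
  v_off : ∀ c, 2 ≤ c → G 1 0 c = -G 0 1 c
  h_diag : ∀ c, c < 2 → G 3 3 c = G 2 2 c
  h_off : ∀ c, c < 2 → G 3 2 c = -G 2 3 c

theorem UmbilicalRelations.self {G : Fin 4 → Fin 4 → Fin 4 → ℝ} (h : UmbilicalRelations G)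
    (a b : Fin 4) : G a b b = 0 := by
  linarith [h.swap a b b]

/-- The algebraic core: `G` are connection coefficients, `D a` their derivatives along `e a`, and
`J` is the Jacobi identity. -/
theorem umbilical_algebra {G : Fin 4 → Fin 4 → Fin 4 → ℝ}
    {D : Fin 4 → Fin 4 → Fin 4 → Fin 4 → ℝ} (hG : UmbilicalRelations G)
    (hD : ∀ a, UmbilicalRelations (D a))
    (J : ∀ a b c d, ((D a b c d - D a c b d) - (D b a c d - D b c a d) + (D c a b d - D c b a d))
      + ∑ f, sgn f * ((G b c f - G c b f) * (G a f d - G f a d)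
        - (G a c f - G c a f) * (G b f d - G f b d)
        + (G a b f - G b a f) * (G c f d - G f c d)) = 0) (t : ℝ)
    {ψ : Fin 4 → ℝ} {dψ : Fin 4 → Fin 4 → ℝ}
    (hψ : ψ = ![t * (G 2 3 1 - G 3 2 1), t * (G 2 3 0 - G 3 2 0),
      -t * (G 0 1 3 - G 1 0 3), t * (G 0 1 2 - G 1 0 2)])
    (hdψ : ∀ a, dψ a = ![t * (D a 2 3 1 - D a 3 2 1), t * (D a 2 3 0 - D a 3 2 0),
      -t * (D a 0 1 3 - D a 1 0 3), t * (D a 0 1 2 - D a 1 0 2)])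
    {N : Fin 4 → Fin 4 → ℝ}
    (hN : ∀ a b, N a b = (dψ a b - ∑ d, sgn d * ψ d * G a b d)
      + (dψ b a - ∑ d, sgn d * ψ d * G b a d)
      - (expansionCoeff G a * ψ b + ψ a * expansionCoeff G b)) :
    N 0 0 = -N 1 1 ∧ N 0 1 = 0 ∧ N 2 2 = N 3 3 ∧ N 2 3 = 0 := by
  -- Normal form: the last two indices are put in increasing order and the umbilical relations
  -- eliminate the redundant coefficients, so that the conclusions become polynomial identities.
  have low : ∀ {G : Fin 4 → Fin 4 → Fin 4 → ℝ} (_ : UmbilicalRelations G),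
      (∀ a, G a 1 0 = -G a 0 1) ∧ (∀ a, G a 2 0 = -G a 0 2) ∧ (∀ a, G a 3 0 = -G a 0 3) ∧
      (∀ a, G a 2 1 = -G a 1 2) ∧ (∀ a, G a 3 1 = -G a 1 3) ∧ (∀ a, G a 3 2 = -G a 2 3) ∧
      (∀ a b, G a b b = 0) ∧ G 1 1 2 = -G 0 0 2 ∧ G 1 1 3 = -G 0 0 3 ∧ G 1 0 2 = -G 0 1 2 ∧
      G 1 0 3 = -G 0 1 3 ∧ G 3 0 3 = G 2 0 2 ∧ G 3 1 3 = G 2 1 2 ∧ G 3 0 2 = -G 2 0 3 ∧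
      G 3 1 2 = -G 2 1 3 := fun {G} h =>
    ⟨fun a => h.swap a 1 0, fun a => h.swap a 2 0, fun a => h.swap a 3 0, fun a => h.swap a 2 1,
      fun a => h.swap a 3 1, fun a => h.swap a 3 2, h.self, h.v_diag 2 (by decide),
      h.v_diag 3 (by decide), h.v_off 2 (by decide), h.v_off 3 (by decide),
      by rw [h.swap 3, h.swap 2, h.h_diag 0 (by decide)],
      by rw [h.swap 3, h.swap 2, h.h_diag 1 (by decide)],
      by rw [h.swap 3, h.swap 2, h.h_off 0 (by decide)],
      by rw [h.swap 3, h.swap 2, h.h_off 1 (by decide)]⟩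
  obtain ⟨g1, g2, g3, g4, g5, g6, g7, g8, g9, g10, g11, g12, g13, g14, g15⟩ := low hG
  have d1 := fun a => (low (hD a)).1
  have d2 := fun a => (low (hD a)).2.1
  have d3 := fun a => (low (hD a)).2.2.1
  have d4 := fun a => (low (hD a)).2.2.2.1
  have d5 := fun a => (low (hD a)).2.2.2.2.1
  have d6 := fun a => (low (hD a)).2.2.2.2.2.1
  have d7 := fun a => (low (hD a)).2.2.2.2.2.2.1
  have d8 := fun a => (low (hD a)).2.2.2.2.2.2.2
  have s0 : sgn 0 = -1 := by simp [sgn]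
  have s1 : sgn 1 = 1 := by simp [sgn]
  have s2 : sgn 2 = 1 := by simp [sgn]
  have s3 : sgn 3 = 1 := by simp [sgn]
  -- The eight instances come in pairs whose mixed derivatives cancel. In `J1 + J2`, for example,
  -- `e_2` acts on `C_031 + C_130 = -(G_013 + G_103) - (G_301 + G_310)`, where the first bracket
  -- vanishes by umbilicity and the second by antisymmetry. What remains differentiated is
  -- `e_0(C_231) + e_1(C_230)`, the derivative part of `N_00 + N_11` up to the factor `2 t`.
  have J1 := J 0 2 3 1
  have J2 := J 1 2 3 0
  have J3 := J 0 2 3 0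
  have J4 := J 1 2 3 1
  have J5 := J 0 1 2 3
  have J6 := J 0 1 3 2
  have J7 := J 0 1 2 2
  have J8 := J 0 1 3 3
  simp only [Fin.sum_univ_four, s0, s1, s2, s3, g1, g2, g3, g4, g5, g6, g7, g8, g9, g10, g11, g12,
    g13, g14, g15, d1, d2, d3, d4, d5, d6, d7, d8] at J1 J2 J3 J4 J5 J6 J7 J8
  simp only [hN, hdψ, hψ, expansionCoeff, Fin.sum_univ_four, s0, s1, s2, s3, Matrix.cons_val,
    g1, g2, g3, g4, g5, g6, g7, g8, g9, g10, g11, g12, g13, g14, g15, d2, d3, d4, d5, d8]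
  refine ⟨?_, ?_, ?_, ?_⟩
  · linear_combination (2 * t) * (J1 + J2)
  · linear_combination t * (J3 + J4)
  · linear_combination (-2 * t) * (J5 + J6)
  · linear_combination t * (J7 - J8)

namespace IsAdaptedFrame

variable {S : Structure22 g} {η : VolumeElement g} {O : Set M} {e : Fin 4 → ∀ y : M, T y} {t : ℝ}

theorem umbilicalRelations (h : IsAdaptedFrame S η O e t) (hS : S.IsUmbilical) {y : M}
    (hy : y ∈ O) : UmbilicalRelations (fun a b c => connCoeff g e a b c y) := by
  have hv : ∀ c : Fin 4, 2 ≤ c → c ∉ ({0, 1} : Finset (Fin 4)) := by decide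
  have hh : ∀ c : Fin 4, c < 2 → c ∉ ({2, 3} : Finset (Fin 4)) := by decide
  refine ⟨fun a b c => h.connCoeff_swap hy a b c, fun c hc => ?_, fun c hc => ?_, fun c hc => ?_,
    fun c hc => ?_⟩
  · obtain ⟨r, hr⟩ := h.umbilical_relation h.v_eq hS.1 hy (hv c hc)
    have h0 := hr 0 (by simp) 0 (by simp)
    have h1 := hr 1 (by simp) 1 (by simp)
    simp [eta, sgn] at h0 h1
    linarith
  · obtain ⟨r, hr⟩ := h.umbilical_relation h.v_eq hS.1 hy (hv c hc)
    have h0 := hr 0 (by simp) 1 (by simp)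
    simp [eta] at h0
    linarith
  · obtain ⟨r, hr⟩ := h.umbilical_relation h.h_eq hS.2 hy (hh c hc)
    have h0 := hr 2 (by simp) 2 (by simp)
    have h1 := hr 3 (by simp) 3 (by simp)
    simp [eta, sgn] at h0 h1
    linarith
  · obtain ⟨r, hr⟩ := h.umbilical_relation h.h_eq hS.2 hy (hh c hc)
    have h0 := hr 2 (by simp) 3 (by simp)
    simp [eta] at h0
    linarith

/-- The relations are linear with constant coefficients and hold on all of the open set `O`, so they
may be differentiated. -/
theorem umbilicalRelations_dir (h : IsAdaptedFrame S η O e t) (hS : S.IsUmbilical) {y : M}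
    (hy : y ∈ O) (V : T y) :
    UmbilicalRelations (fun a b c => dir (connCoeff g e a b c) V) := by
  have hd := fun a b c => h.fdiffAt_connCoeff hy a b c
  have hneg : ∀ a b c a' b' c', (∀ z ∈ O, connCoeff g e a b c z = -connCoeff g e a' b' c' z) →
      dir (connCoeff g e a b c) V = -dir (connCoeff g e a' b' c') V := by
    intro a b c a' b' c' hz
    rw [h.dir_eq_of_eqOn hy (f' := fun z => -1 * connCoeff g e a' b' c' z)
      (fun z hz' => by rw [hz z hz']; ring), dir_const_mul _ (hd _ _ _)]
    ring
  exact ⟨fun a b c => hneg _ _ _ _ _ _ fun z hz => h.connCoeff_swap hz a b c,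
    fun c hc => hneg _ _ _ _ _ _ fun z hz => (h.umbilicalRelations hS hz).v_diag c hc,
    fun c hc => hneg _ _ _ _ _ _ fun z hz => (h.umbilicalRelations hS hz).v_off c hc,
    fun c hc => h.dir_eq_of_eqOn hy (fun z hz => (h.umbilicalRelations hS hz).h_diag c hc) V,
    fun c hc => hneg _ _ _ _ _ _ fun z hz => (h.umbilicalRelations hS hz).h_off c hc⟩

theorem dir_structCoeff (h : IsAdaptedFrame S η O e t) {y : M} (hy : y ∈ O) (a b c : Fin 4)
    (V : T y) : dir (structCoeff g e a b c) V =
      dir (connCoeff g e a b c) V - dir (connCoeff g e b a c) V := by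
  have hd := fun a b c => h.fdiffAt_connCoeff hy a b c
  rw [h.dir_eq_of_eqOn hy (f' := fun z => connCoeff g e a b c z + -1 * connCoeff g e b a c z)
    (fun z hz => by rw [h.structCoeff_eq hz]; ring), dir_add (hd _ _ _)
    (f' := fun z => -1 * connCoeff g e b a c z) (mdifferentiableAt_const.mul (hd _ _ _)),
    dir_const_mul _ (hd _ _ _)]
  ring

theorem N_frame_relations (h : IsAdaptedFrame S η O e t) (hS : S.IsUmbilical) {y : M}
    (hy : y ∈ O) :
    S.N η y (e 0 y) (e 0 y) = -S.N η y (e 1 y) (e 1 y) ∧ S.N η y (e 0 y) (e 1 y) = 0 ∧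
    S.N η y (e 2 y) (e 2 y) = S.N η y (e 3 y) (e 3 y) ∧ S.N η y (e 2 y) (e 3 y) = 0 := by
  refine umbilical_algebra (G := fun a b c => connCoeff g e a b c y)
    (D := fun x a b c => dir (connCoeff g e a b c) (e x y))
    (N := fun a b => S.N η y (e a y) (e b y)) (t := t)
    (ψ := fun d => rotationCoeff g e t d y)
    (dψ := fun a b => dir (rotationCoeff g e t b) (e a y))
    (h.umbilicalRelations hS hy) (fun a => h.umbilicalRelations_dir hS hy _) ?_ ?_ ?_
    (h.N_frame hy)
  · intro a b c d
    have := h.jacobi hy a b c d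
    simpa only [h.dir_structCoeff hy, h.structCoeff_eq hy] using this
  · ext d
    fin_cases d <;> simp [rotationCoeff, h.structCoeff_eq hy]
  · intro a
    have hc : ∀ r a b c V, dir (fun z => r * structCoeff g e a b c z) V =
        r * (dir (connCoeff g e a b c) V - dir (connCoeff g e b a c) V) := fun r a b c V => by
      rw [dir_const_mul _ (h.fdiffAt_structCoeff hy a b c), h.dir_structCoeff hy]
    ext d
    fin_cases d <;> simp only [rotationCoeff] <;> exact hc _ _ _ _ _

theorem N_symm (h : IsAdaptedFrame S η O e t) {y : M} (hy : y ∈ O) (X Y : T y) :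
    S.N η y X Y = S.N η y Y X := by
  rw [h.N_eq hy, h.N_eq hy, g.symm y X, g.symm y Y]; ring

end IsAdaptedFrame

/-! ### Existence of adapted frames -/

section Existence

variable {x : M}

theorem smoothAt_ext (X : T x) : SmoothAt ∞ (ext X) x :=
  FiberBundle.contMDiffAt_extend (𝓡 4) E4 X

theorem SmoothAt.sum_smul {ι : Type*} {s : Finset ι} {f : ι → M → ℝ} {e : ι → ∀ y : M, T y}
    (hf : ∀ i ∈ s, ContMDiffAt (𝓡 4) 𝓘(ℝ, ℝ) ∞ (f i) x) (he : ∀ i ∈ s, SmoothAt ∞ (e i) x) :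
    SmoothAt ∞ (fun y => ∑ i ∈ s, f i y • e i y) x :=
  ContMDiffAt.sum_section (V := fun y : M => TangentSpace (𝓡 4) y)
    fun i hi => ContMDiffAt.smul_section (hf i hi) (he i hi)

/-- A smooth field whose square is `±1` at `x` can be normalized near `x`. -/
theorem exists_normalization {A : ∀ y : M, T y} (hA : SmoothAt ∞ A x) (k : Fin 4)
    (hx : g.inner x (A x) (A x) = sgn k) :
    ∃ c : M → ℝ, ContMDiffAt (𝓡 4) 𝓘(ℝ, ℝ) ∞ c x ∧ c x = 1 ∧
      ∀ᶠ y in nhds x, g.inner y (c y • A y) (c y • A y) = sgn k := by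
  have h1 : ContMDiffAt (𝓡 4) 𝓘(ℝ, ℝ) ∞ (fun y => sgn k * g.inner y (A y) (A y)) x :=
    contMDiffAt_const.mul (contMDiffAt_bilin g.smooth hA hA)
  have hq : sgn k * g.inner x (A x) (A x) = 1 := by rw [hx, sgn_mul_self]
  have h2 : ContDiffAt ℝ ∞ (fun r : ℝ => (√r)⁻¹) (sgn k * g.inner x (A x) (A x)) := by
    rw [hq]
    exact (Real.contDiffAt_sqrt one_ne_zero).inv (by simp)
  -- The radicand is 1 at `x`, hence positive nearby, where the square root is smooth.
  refine ⟨fun y => (√(sgn k * g.inner y (A y) (A y)))⁻¹,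
    ContMDiffAt.comp (g := fun r => (√r)⁻¹) x h2.contMDiffAt h1, by simp only [hq]; simp, ?_⟩
  have hpos := h1.continuousAt.eventually (lt_mem_nhds (a := 0) (by simp only [hq]; exact one_pos))
  filter_upwards [hpos] with y hy
  simp only [map_smul, _root_.smul_apply, smul_eq_mul]
  have h3 := Real.mul_self_sqrt hy.le
  have h4 := (Real.sqrt_pos.2 hy).ne'
  set r := √(sgn k * g.inner y (A y) (A y))
  have h5 : g.inner y (A y) (A y) = sgn k * (r * r) := by
    rw [h3, ← mul_assoc, sgn_mul_self, one_mul]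
  rw [h5]
  field_simp

/-- One step of the Gram-Schmidt process. -/
theorem exists_gramSchmidt_step {e : Fin 4 → ∀ y : M, T y} (k : Fin 4)
    (hs : ∀ i, SmoothAt ∞ (e i) x) (hx : g.IsOrthonormal fun i => e i x)
    (ho : ∀ᶠ y in nhds x, ∀ i < k, ∀ j < k,
      g.inner y (e i y) (e j y) = if i = j then sgn i else 0) :
    ∃ W : ∀ y : M, T y, SmoothAt ∞ W x ∧ W x = e k x ∧
      ∀ᶠ y in nhds x, g.inner y (W y) (W y) = sgn k ∧ ∀ i < k, g.inner y (e i y) (W y) = 0 := by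
  let A : ∀ y : M, T y := fun y =>
    e k y - ∑ i ∈ Finset.Iio k, (sgn i * g.inner y (e i y) (e k y)) • e i y
  have hA : SmoothAt ∞ A x :=
    ContMDiffAt.sub_section (V := fun y : M => TangentSpace (𝓡 4) y) (hs k)
      (SmoothAt.sum_smul (fun i _ => contMDiffAt_const.mul
        (contMDiffAt_bilin g.smooth (hs i) (hs k))) fun i _ => hs i)
  have hAx : A x = e k x := by
    have : ∑ i ∈ Finset.Iio k, (sgn i * g.inner x (e i x) (e k x)) • e i x = 0 :=
      Finset.sum_eq_zero fun i hi => by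
        rw [hx i k, if_neg (Finset.mem_Iio.1 hi).ne, mul_zero, zero_smul]
    simp only [A, this, sub_zero]
  have hxk : g.inner x (A x) (A x) = sgn k := by rw [hAx]; simpa using hx k k
  obtain ⟨c, hc, hc1, hc2⟩ := exists_normalization hA k hxk
  refine ⟨fun y => c y • A y,
    ContMDiffAt.smul_section (V := fun y : M => TangentSpace (𝓡 4) y) hc hA,
    by simp only [hc1, hAx, one_smul], ?_⟩
  filter_upwards [hc2, ho] with y h1 h2
  refine ⟨h1, fun i hi => ?_⟩
  have : g.inner y (e i y) (A y) = 0 := by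
    simp only [A, map_sub, map_sum, map_smul, smul_eq_mul]
    rw [Finset.sum_eq_single_of_mem i (Finset.mem_Iio.2 hi), h2 i hi i hi]
    · rw [if_pos rfl, mul_right_comm, sgn_mul_self]; ring
    · intro j hj hji
      rw [h2 i hi j (Finset.mem_Iio.1 hj), if_neg hji.symm, mul_zero]
  rw [map_smul, this, smul_zero]

/-- The Gram-Schmidt process applied to smooth fields that are orthonormal at `x`, the first `n`
of them being orthonormal near `x`. -/
theorem exists_gramSchmidt (m : ℕ) : ∀ (n : ℕ), n + m = 4 → ∀ {e : Fin 4 → ∀ y : M, T y},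
    (∀ i, SmoothAt ∞ (e i) x) → (g.IsOrthonormal fun i => e i x) →
    (∀ᶠ y in nhds x, ∀ i : Fin 4, i.val < n → ∀ j : Fin 4, j.val < n →
      g.inner y (e i y) (e j y) = if i = j then sgn i else 0) →
    ∃ f : Fin 4 → ∀ y : M, T y, (∀ i, i.val < n → f i = e i) ∧ (∀ i, SmoothAt ∞ (f i) x) ∧
      (∀ i, f i x = e i x) ∧ ∀ᶠ y in nhds x, g.IsOrthonormal fun i => f i y := by
  induction m with
  | zero =>
    intro n hn e hs _ ho
    refine ⟨e, fun _ _ => rfl, hs, fun _ => rfl, ho.mono fun y hy i j => hy i ?_ j ?_⟩ <;> omega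
  | succ m ih =>
    intro n hn e hs hx ho
    obtain ⟨W, hW, hWx, hWo⟩ := exists_gramSchmidt_step ⟨n, by omega⟩ hs hx
      (ho.mono fun y hy i hi j hj => hy i hi j hj)
    set k : Fin 4 := ⟨n, by omega⟩
    have hk : Function.update e k W k = W := Function.update_self ..
    have hn' : ∀ i, i ≠ k → Function.update e k W i = e i := fun i hi => Function.update_of_ne hi ..
    have hlt : ∀ i : Fin 4, i.val < n → i ≠ k := fun i hi h => by
      rw [h] at hi; exact lt_irrefl n hi
    have hex : ∀ i, Function.update e k W i x = e i x := fun i => by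
      by_cases h : i = k
      · rw [h, hk, hWx]
      · rw [hn' i h]
    obtain ⟨f, h1, h2, h3, h4⟩ := ih (n + 1) (by omega) (e := Function.update e k W) (fun i => by
      by_cases h : i = k
      · rw [h, hk]; exact hW
      · rw [hn' i h]; exact hs i) (by simpa only [hex] using hx) (by
      filter_upwards [ho, hWo] with y hy hy' i hi j hj
      have hc : ∀ i : Fin 4, i.val < n + 1 → i ≠ k → i.val < n := fun i hi h =>
        lt_of_le_of_ne (Nat.lt_succ_iff.1 hi) fun h' => h (Fin.ext h')
      by_cases hik : i = k <;> by_cases hjk : j = k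
      · rw [hik, hjk, hk, if_pos rfl]; exact hy'.1
      · rw [hik, hk, hn' j hjk, if_neg (Ne.symm hjk), g.symm]; exact hy'.2 j (hc j hj hjk)
      · rw [hjk, hk, hn' i hik, if_neg hik]; exact hy'.2 i (hc i hi hik)
      · rw [hn' i hik, hn' j hjk]; exact hy i (hc i hi hik) j (hc j hj hjk))
    exact ⟨f, fun i hi => (h1 i (Nat.lt_succ_of_lt hi)).trans (hn' i (hlt i hi)), h2,
      fun i => (h3 i).trans (hex i), h4⟩

namespace Structure22

variable (S : Structure22 g)

theorem inner_toEnd (X Z : T x) : g.inner x (toEnd g S.form x X) Z = S.U x X Z :=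
  inner_sharp (S.U x X : T x →ₗ[ℝ] ℝ).isLinear Z

theorem form_swap (X Y : T x) : S.U x X Y = -S.U x Y X := by
  obtain ⟨e, -, he⟩ := S.volume_timelike x
  rw [he, he]; ring

/-- The Plücker relation of a simple 2-form. It recovers `U` near `x` from its contractions with two
vectors that span the plane. -/
theorem form_decomposable (X Y Z W : T x) :
    S.U x X Y * S.U x Z W = S.U x X Z * S.U x Y W - S.U x X W * S.U x Y Z := by
  obtain ⟨e, -, he⟩ := S.volume_timelike x
  simp only [he]; ring

theorem toEnd_smul (c : ℝ) (X : T x) :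
    toEnd g S.form x (c • X) = c • toEnd g S.form x X :=
  g.eq_of_inner_eq fun Z => by
    simp only [map_smul, _root_.smul_apply, inner_toEnd]

theorem toEnd_eq {e : Fin 4 → T x} (he : ∀ X Y, S.U x X Y =
    g.inner x (e 0) X * g.inner x (e 1) Y - g.inner x (e 0) Y * g.inner x (e 1) X) (X : T x) :
    toEnd g S.form x X = g.inner x (e 0) X • e 1 - g.inner x (e 1) X • e 0 :=
  g.eq_of_inner_eq fun Z => by
    simp only [inner_toEnd, he, map_sub, map_smul, _root_.sub_apply, _root_.smul_apply, smul_eq_mul]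
    ring

/-- This is `U³ = U`; it makes `v` fix its own image. -/
theorem toEnd_v (X : T x) : toEnd g S.form x (S.v x X) = toEnd g S.form x X := by
  obtain ⟨e, ho, he⟩ := S.volume_timelike x
  have ho' : ∀ i j, g.inner x (e i) (e j) = if i = j then sgn i else 0 := ho
  simp only [v, S.toEnd_eq he, map_sub, map_smul, smul_eq_mul, ho']
  simp [sgn]

theorem smoothAt_toEnd {F : Fin 4 → ∀ y : M, T y} (hF : ∀ i, SmoothAt ∞ (F i) x)
    (ho : ∀ᶠ y in nhds x, g.IsOrthonormal fun i => F i y) {X : ∀ y : M, T y}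
    (hX : SmoothAt ∞ X x) : SmoothAt ∞ (fun y => toEnd g S.form y (X y)) x := by
  have h1 : SmoothAt ∞ (fun y => ∑ i, (sgn i * S.U y (X y) (F i y)) • F i y) x :=
    SmoothAt.sum_smul (fun i _ => contMDiffAt_const.mul (contMDiffAt_bilin S.smooth hX (hF i)))
      fun i _ => hF i
  refine ContMDiffAt.congr_of_eventuallyEq h1 (ho.mono fun y hy => ?_)
  have := hy.sharp_eq (S.U y (X y) : T y →ₗ[ℝ] ℝ).isLinear
  exact congrArg (Bundle.TotalSpace.mk y) this

theorem exists_adaptedFrame (η : VolumeElement g) (x : M) :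
    ∃ (O : Set M) (e : Fin 4 → ∀ y : M, T y) (t : ℝ), x ∈ O ∧ IsAdaptedFrame S η O e t := by
  obtain ⟨e, he, hU⟩ := S.volume_timelike x
  have he' : ∀ i j, g.inner x (e i) (e j) = if i = j then sgn i else 0 := he
  -- This first frame need not be adapted away from `x`. It lets indices be raised smoothly and
  -- supplies the fields from which the adapted frame is built.
  obtain ⟨F, -, hF, hFx, hFo⟩ := exists_gramSchmidt 4 0 rfl (e := fun i => ext (e i))
    (fun i => smoothAt_ext (e i)) (by simpa only [ext_apply_self] using he)
    (Filter.Eventually.of_forall fun y i hi => absurd hi (Nat.not_lt_zero _))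
  simp only [ext_apply_self] at hFx
  have hA : SmoothAt ∞ (fun y => S.v y (F 0 y)) x :=
    S.smoothAt_toEnd hF hFo (S.smoothAt_toEnd hF hFo (hF 0))
  have hAx : S.v x (F 0 x) = e 0 := by
    simp only [v, S.toEnd_eq hU, hFx, map_sub, map_smul, smul_eq_mul, he']
    simp [sgn]
  obtain ⟨c, hc, hc1, hc2⟩ := exists_normalization (g := g) hA 0 (by simpa [hAx] using he 0 0)
  let f0 : ∀ y : M, T y := fun y => c y • S.v y (F 0 y)
  -- The sign comes from `toEnd g S.form x (e 0) = -e 1`, as `e 0` is time-like.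
  let f1 : ∀ y : M, T y := fun y => (-1 : ℝ) • toEnd g S.form y (f0 y)
  have hf0 : SmoothAt ∞ f0 x :=
    ContMDiffAt.smul_section (V := fun y : M => TangentSpace (𝓡 4) y) hc hA
  have hf1 : SmoothAt ∞ f1 x :=
    ContMDiffAt.const_smul_section (V := fun y : M => TangentSpace (𝓡 4) y)
      (S.smoothAt_toEnd hF hFo hf0)
  have hf0x : f0 x = e 0 := by simp only [f0, hc1, hAx, one_smul]
  have hf1x : f1 x = e 1 := by
    simp only [f1, hf0x, S.toEnd_eq hU, he']
    simp [sgn]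
  have hvf : ∀ y, S.v y (f0 y) = f0 y := fun y => by
    simp only [f0, v, S.toEnd_smul]
    rw [show toEnd g S.form y (toEnd g S.form y (F 0 y)) = S.v y (F 0 y) from rfl, S.toEnd_v]
    rfl
  have hU0 : ∀ y Z, S.U y (f0 y) Z = -g.inner y (f1 y) Z := fun y Z => by
    simp only [f1, map_smul, _root_.smul_apply, smul_eq_mul, inner_toEnd]; ring
  have hU1 : ∀ y Z, S.U y (f1 y) Z = -g.inner y (f0 y) Z := fun y Z => by
    simp only [f1, map_smul, _root_.smul_apply, smul_eq_mul]
    rw [← S.inner_toEnd, show toEnd g S.form y (toEnd g S.form y (f0 y)) = S.v y (f0 y) from rfl,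
      hvf]
    ring
  have h00 : ∀ᶠ y in nhds x, g.inner y (f0 y) (f0 y) = -1 :=
    hc2.mono fun y hy => hy.trans (by simp [sgn])
  have h01 : ∀ y, g.inner y (f0 y) (f1 y) = 0 := fun y => by
    have h1 := hU0 y (f0 y)
    have h2 := S.form_swap (f0 y) (f0 y)
    rw [g.symm]; linarith
  have h11 : ∀ y, g.inner y (f1 y) (f1 y) = -g.inner y (f0 y) (f0 y) := fun y => by
    have h1 := hU0 y (f1 y)
    have h2 := hU1 y (f0 y)
    have h3 := S.form_swap (f0 y) (f1 y)
    linarith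
  -- Two steps remain, and they leave `f0` and `f1`, which already span `V` near `x`, unchanged.
  obtain ⟨f, hf, hfs, hfx, hfo⟩ := exists_gramSchmidt 2 2 rfl (e := ![f0, f1, F 2, F 3])
    (by intro i; fin_cases i; exacts [hf0, hf1, hF 2, hF 3])
    (by
      have : (fun i => (![f0, f1, F 2, F 3] : Fin 4 → ∀ y : M, T y) i x) = e := by
        funext i; fin_cases i; exacts [hf0x, hf1x, hFx 2, hFx 3]
      rw [this]; exact he)
    (by
      filter_upwards [h00] with y hy i hi j hj
      have hi' : i = 0 ∨ i = 1 := by omega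
      have hj' : j = 0 ∨ j = 1 := by omega
      rcases hi' with rfl | rfl <;> rcases hj' with rfl | rfl
      · simpa [sgn] using hy
      · simpa using h01 y
      · simpa [g.symm y (f1 y)] using h01 y
      · simp [sgn, h11, hy])
  have hf0' : f 0 = f0 := hf 0 (by decide)
  have hf1' : f 1 = f1 := hf 1 (by decide)
  have hη := (η.smooth x f hfs).continuousAt
  -- A continuous function with values `±1` is locally constant: a change of sign would be a jump of
  -- 2.
  have hη' : ∀ᶠ y in nhds x, η.form y (fun i => f i y) = η.form x (fun i => f i x) := by
    have h1 := η.normalized x _ hfo.self_of_nhds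
    filter_upwards [hfo, Metric.continuousAt_iff'.1 hη 1 one_pos] with y hy hd
    have h2 := η.normalized y _ hy
    rw [Real.dist_eq] at hd
    rw [sq, mul_self_eq_one_iff] at h1 h2
    rcases h1 with h1 | h1 <;> rcases h2 with h2 | h2 <;>
      rw [h1, h2] at hd ⊢ <;> norm_num at hd
  have i2 : IsManifold (𝓡 4) 2 M := isManifold_of_nat (M := M) 2
  have i3 : IsManifold (𝓡 4) (2 + 1) M := by
    have : (2 : ℕ∞ω) + 1 = (3 : ℕ) := by norm_num
    rw [this]; exact isManifold_of_nat (M := M) 3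
  have i4 : IsManifold (𝓡 4).tangent 2 (TangentBundle (𝓡 4) M) :=
    Bundle.TotalSpace.isManifold E4 (fun y : M => TangentSpace (𝓡 4) y)
  -- Being `C^∞` at `x` gives a neighbourhood only for each finite order; order 2 suffices for the
  -- Jacobi identity.
  have hs2 : ∀ᶠ y in nhds x, ∀ i, SmoothAt 2 (f i) y :=
    Filter.eventually_all.2 fun i => (contMDiffAt_iff_contMDiffAt_nhds (by simp)).1
      ((hfs i).of_le (ENat.LEInfty.out (m := 2)))
  obtain ⟨O, hO, hOo, hxO⟩ := eventually_nhds_iff.1 (hs2.and (hfo.and hη'))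
  refine ⟨O, f, _, hxO, ⟨⟨hOo, fun y hy => (hO y hy).1, fun y hy => (hO y hy).2.1⟩,
    fun y hy => ?_, fun y hy => (hO y hy).2.2⟩⟩
  ext X Y
  -- Here `U(f_0, f_1) = -1`, `U(f_0, ·) = -θ_1` and `U(f_1, ·) = -θ_0`, so the Plücker relation
  -- reads `U = θ_0 ∧ θ_1`.
  have hd := S.form_decomposable (f 0 y) (f 1 y) X Y
  have h11y : g.inner y (f 1 y) (f 1 y) = 1 := by simpa [sgn] using (hO y hy).2.1 1 1
  rw [hf0', hf1'] at hd
  rw [hf1'] at h11y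
  simp only [hU0, hU1, h11y] at hd
  rw [wedge, hf0', hf1']
  change S.U y X Y = _
  linarith

end Structure22

end Existence

/-! ### The main theorem -/

/-- A bilinear tensor that is diagonal with equal entries on a frame of a plane is on that plane
pure trace. -/
theorem totalProj_eq_trace {O : Set M} {e : Fin 4 → ∀ y : M, T y} {P : EndField M} {i j : Fin 4}
    (h : IsLocalFrame g O e) (hP : IsFrameProjector g O e {i, j} P) (hij : i ≠ j) {B : Tensor2 M}
    {y : M} (hy : y ∈ O) (hB : IsBilinearMap ℝ (B y)) (h1 : B y (e i y) (e j y) = 0)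
    (h2 : B y (e j y) (e i y) = 0)
    (h3 : sgn i * B y (e i y) (e i y) = sgn j * B y (e j y) (e j y)) (X Y : T y) :
    totalProj P B y X Y = (1 / 2) * trace g y (totalProj P B y) * g.inner y (P y X) Y := by
  obtain ⟨L, hL⟩ : ∃ L : T y →ₗ[ℝ] T y →ₗ[ℝ] ℝ, ∀ Z W, B y Z W = L Z W :=
    ⟨hB.toLinearMap, fun _ _ => rfl⟩
  have hPe : ∀ Z : T y, P y Z = (sgn i * g.inner y (e i y) Z) • e i y
      + (sgn j * g.inner y (e j y) Z) • e j y := fun Z => by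
    rw [hP y hy, Finset.sum_pair hij]
  have hb : IsBilinearMap ℝ (totalProj P B y) := by
    simp only [funext fun Z => funext fun W => show totalProj P B y Z W = L (P y Z) (P y W) from
      hL _ _]
    constructor <;> intros <;> simp only [hPe, map_add, map_smul, LinearMap.add_apply,
      LinearMap.smul_apply, smul_eq_mul] <;> ring
  have ht : trace g y (totalProj P B y) = sgn i * B y (e i y) (e i y)
      + sgn j * B y (e j y) (e j y) := by
    rw [(h.orthonormal y hy).trace_eq hb, ← Finset.sum_pair hij
      (f := fun k => sgn k * B y (e k y) (e k y)), ← Finset.sum_subset (Finset.subset_univ {i, j})]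
    · refine Finset.sum_congr rfl fun k hk => ?_
      rw [totalProj, h.projector_frame hP hy, if_pos hk, smul_eq_mul]
    · intro k _ hk
      rw [totalProj, h.projector_frame hP hy, if_neg hk, hL, map_zero, smul_zero]
  rw [ht, h3, totalProj, hPe X, hPe Y]
  rw [hL] at h1 h2
  simp only [hL] at h3 ⊢
  simp only [map_add, map_smul, LinearMap.add_apply, LinearMap.smul_apply, _root_.add_apply,
    _root_.smul_apply, smul_eq_mul, h1, h2]
  linear_combination (g.inner y (e i y) X * g.inner y (e i y) Y * sgn i) * h3

end SpaceTime

end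

theorem mainTheorem10 {M : Type*} [TopologicalSpace M] [ChartedSpace SpaceTime.E4 M]
    [IsManifold (𝓡 4) ∞ M] (g : SpaceTime.LorentzMetric M) (η : SpaceTime.VolumeElement g)
    (S : SpaceTime.Structure22 g) (hS : S.IsUmbilical) :
    ∃ lam mu : M → ℝ, ∀ x : M,
      (∀ X Y : SpaceTime.T x,
        SpaceTime.totalProj S.v (S.N η) x X Y = lam x * g.inner x (S.v x X) Y) ∧
      (∀ X Y : SpaceTime.T x,
        SpaceTime.totalProj S.h (S.N η) x X Y = mu x * g.inner x (S.h x X) Y) ∧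
      lam x = (1 / 2) * SpaceTime.trace g x (SpaceTime.totalProj S.v (S.N η) x) ∧
      mu x = (1 / 2) * SpaceTime.trace g x (SpaceTime.totalProj S.h (S.N η) x) := by
  -- Both scalars are defined globally by the traces, so the adapted frames around different points
  -- need not be patched together.
  refine ⟨fun x => (1 / 2) * SpaceTime.trace g x (SpaceTime.totalProj S.v (S.N η) x),
    fun x => (1 / 2) * SpaceTime.trace g x (SpaceTime.totalProj S.h (S.N η) x), fun x => ?_⟩
  obtain ⟨O, e, t, hx, h⟩ := S.exists_adaptedFrame η x
  obtain ⟨h00, h01, h22, h23⟩ := h.N_frame_relations hS hx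
  refine ⟨fun X Y => ?_, fun X Y => ?_, rfl, rfl⟩
  · exact SpaceTime.totalProj_eq_trace h.toIsLocalFrame h.v_eq (by decide) hx (h.isBilinearMap_N hx)
      h01 (by rw [h.N_symm hx, h01]) (by simp [SpaceTime.sgn, h00]) X Y
  · exact SpaceTime.totalProj_eq_trace h.toIsLocalFrame h.h_eq (by decide) hx (h.isBilinearMap_N hx)
      h23 (by rw [h.N_symm hx, h23]) (by simp [SpaceTime.sgn, h22]) X Y
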